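/- Let $\mathbb{F}_q$ be a finite field with $q$ odd, $\psi:\mathbb{F}_q\to\mathbb{C}^\times$ a non-trivial additive character and $\sigma$ the quadratic character of $\mathbb{F}_q^\times$. Let $\mathsf{Symp}$ be the groupoid of finite dimensional symplectic vector spaces over $\mathbb{F}_q$ and symplectic linear isomorphisms. For $V=(V,\omega)\in\mathsf{Symp}$, $\dim V=2n$, let $H=H(V)=V\times\mathbb{F}_q$ be the Heisenberg group, $(v,z)(v',z')=(v+v',z+z'+\tfrac12\omega(v,v'))$. An oriented isotropic (Lagrangian) subspace $I^\circ=(I,o_I)$ is an isotropic (Lagrangian) subspace $I\subset V$ together with a non-zero $o_I\in\bigwedge^{\mathrm{top}}I$. For an oriented Lagrangian $L^\circ$ let $\mathcal{H}_{L^\circ}$ be the space of functions $f:H\to\mathbb{C}$ with $f((0,z)h)=\psi(z)f(h)$ and $f((l,0)h)=f(h)$ for all $z\in\mathbb{F}_q$, $l\in L$, $h\in H$, on which $H$ acts by right translations. There is a unique system of $H$-intertwining maps $F_{M^\circ,L^\circ}:\mathcal{H}_{L^\circ}\to\mathcal{H}_{M^\circ}$, indexed by all pairs of oriented Lagrangians,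 with $F_{N^\circ,L^\circ}=F_{N^\circ,M^\circ}\circ F_{M^\circ,L^\circ}$ for all $N^\circ,M^\circ,L^\circ$ and, whenever $L\cap M=0$, $$F_{M^\circ,L^\circ}[f](h)=\Big(\frac{G_1}{q}\Big)^n\sigma\big((-1)^{\binom n2}\omega_\wedge(o_L,o_M)\big)\sum_{m\in M}f((m,0)h),\qquad G_1=\sum_{z\in\mathbb{F}_q}\psi(\tfrac12z^2),$$ where $\omega_\wedge(l_1\wedge\dots\wedge l_n,m_1\wedge\dots\wedge m_n)=(-1)^{\binom n2}\det(\omega(l_i,m_j))$. Let $\mathcal{H}(V)$ be the space of families $(v_{L^\circ}\in\mathcal{H}_{L^\circ})_{L^\circ}$ with $F_{M^\circ,L^\circ}(v_{L^\circ})=v_{M^\circ}$ for all $M^\circ,L^\circ$. It carries the action of $H(V)$ by right translations. A symplectic isomorphism $f:V\to U$ induces $\mathcal{H}(f):\mathcal{H}(U)\to\mathcal{H}(V)$, $(\mathcal{H}(f)v)_{L^\circ}(x,z)=v_{f(L^\circ)}(f(x),z)$, and $\rho_V(g)=\mathcal{H}(g^{-1})$ defines a representation of $Sp(V)$ on $\mathcal{H}(V)$.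 For $I\subset V$ isotropic let $\mathcal{H}(V)^I$ be the subspace of vectors fixed by all $(i,0)$, $i\in I$, and let $I^\perp/I$ carry the symplectic form induced by $\omega$. Then there are linear isomorphisms $$\alpha_{(I^\circ,V)}:\mathcal{H}(V)^I\longrightarrow\mathcal{H}(I^\perp/I),$$ one for every $V\in\mathsf{Symp}$ and every oriented isotropic subspace $I^\circ$ of $V$, that are natural: for every symplectic isomorphism $f:V\to U$ with $f(I^\circ)=J^\circ$, with induced isomorphism $f_I:I^\perp/I\to J^\perp/J$, $$\mathcal{H}(f_I)\circ\alpha_{(J^\circ,U)}=\alpha_{(I^\circ,V)}\circ\mathcal{H}(f)\quad\text{on }\mathcal{H}(U)^J.$$ Consequently, if $P\subset Sp(V)$ is the subgroup of all $g$ with $g(I^\circ)=I^\circ$ and $\pi:P\to Sp(I^\perp/I)$ is the canonical homomorphism, then $\mathcal{H}(V)^I$ is stable under $\rho_V|_P$ and $\alpha_{(I^\circ,V)}$ is an isomorphism of representations of $P$ from $\mathcal{H}(V)^I$ (with the action $\rho_V|_P$) to $\rho_{I^\perp/I}\circ\pi$. -/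

import Mathlib

open Module

universe w u

noncomputable section

/-! ## Symplectic vector spaces and their isomorphisms -/

/-- A finite dimensional symplectic vector space over `F`. -/
structure SympSpace (F : Type w) [Field F] where
  carrier : Type u
  [addCommGroup : AddCommGroup carrier]
  [module : Module F carrier]
  [finiteDimensional : FiniteDimensional F carrier]
  form : LinearMap.BilinForm F carrier
  isAlt : form.IsAlt
  nondegenerate : form.Nondegenerate

attribute [instance] SympSpace.addCommGroup SympSpace.module SympSpace.finiteDimensional

namespace SympSpace

instance {F : Type w} [Field F] : CoeSort (SympSpace.{w, u} F) (Type u) := ⟨carrier⟩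

/-- A linear isomorphism `V → U` of symplectic vector spaces. -/
structure Iso {F : Type w} [Field F] (V U : SympSpace.{w, u} F) extends V ≃ₗ[F] U where
  map_form : ∀ x y, U.form (toFun x) (toFun y) = V.form x y

end SympSpace

variable {F : Type w} [Field F]

namespace SympSpace.Iso

variable {V U W : SympSpace.{w, u} F}

theorem toLinearEquiv_injective :
    Function.Injective (toLinearEquiv : Iso V U → (V ≃ₗ[F] U)) := by
  rintro ⟨_, _⟩ ⟨_, _⟩ rfl; rfl

theorem form_apply (f : Iso V U) (x y : V) :
    U.form (f.toLinearEquiv x) (f.toLinearEquiv y) = V.form x y := f.map_form x y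

def refl (V : SympSpace.{w, u} F) : Iso V V := ⟨LinearEquiv.refl F V, fun _ _ => rfl⟩

def trans (f : Iso V U) (g : Iso U W) : Iso V W :=
  ⟨f.toLinearEquiv.trans g.toLinearEquiv,
    fun x y => (g.form_apply _ _).trans (f.form_apply x y)⟩

def symm (f : Iso V U) : Iso U V :=
  ⟨f.toLinearEquiv.symm, fun x y => by
    have := f.form_apply (f.toLinearEquiv.symm x) (f.toLinearEquiv.symm y)
    simpa using this.symm⟩

/-- The symplectic group `Sp(V)`; the product is composition. -/
instance : Group (Iso V V) where
  mul g h := h.trans g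
  one := refl V
  inv g := g.symm
  mul_assoc _ _ _ := rfl
  one_mul _ := rfl
  mul_one _ := rfl
  inv_mul_cancel g := toLinearEquiv_injective (g.toLinearEquiv.self_trans_symm)

end SympSpace.Iso

/-! ## The Heisenberg group -/

/-- The set `V × F` underlying the Heisenberg group. -/
@[ext] structure Heisenberg (V : SympSpace.{w, u} F) where
  vec : V
  z : F

namespace Heisenberg

variable {V U : SympSpace.{w, u} F}

/-- `(v, z) * (v', z') = (v + v', z + z' + ω(v, v') / 2)`. -/
instance : Mul (Heisenberg V) :=
  ⟨fun a b => ⟨a.vec + b.vec, a.z + b.z + 2⁻¹ * V.form a.vec b.vec⟩⟩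

instance : One (Heisenberg V) := ⟨⟨0, 0⟩⟩

instance : Inv (Heisenberg V) := ⟨fun a => ⟨-a.vec, -a.z⟩⟩

@[simp] theorem mul_vec (a b : Heisenberg V) : (a * b).vec = a.vec + b.vec := rfl
@[simp] theorem mul_z (a b : Heisenberg V) :
    (a * b).z = a.z + b.z + 2⁻¹ * V.form a.vec b.vec := rfl
@[simp] theorem one_vec : (1 : Heisenberg V).vec = 0 := rfl
@[simp] theorem one_z : (1 : Heisenberg V).z = 0 := rfl
@[simp] theorem inv_vec (a : Heisenberg V) : (a⁻¹).vec = -a.vec := rfl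
@[simp] theorem inv_z (a : Heisenberg V) : (a⁻¹).z = -a.z := rfl

instance : Group (Heisenberg V) where
  mul_assoc a b c := by
    ext
    · simp [add_assoc]
    · simp; ring
  one_mul a := by ext <;> simp
  mul_one a := by ext <;> simp
  inv_mul_cancel a := by
    ext
    · simp
    · simp [V.isAlt.self_eq_zero]

/-- The element `(v, 0)`. -/
def ofVec (v : V) : Heisenberg V := ⟨v, 0⟩

/-- The element `(0, z)` of the center. -/
def ofCenter (z : F) : Heisenberg V := ⟨0, z⟩

/-- The map `(v, z) ↦ (f v, z)` induced by a symplectic isomorphism. -/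
def map (f : SympSpace.Iso V U) : Heisenberg V →* Heisenberg U where
  toFun h := ⟨f.toLinearEquiv h.vec, h.z⟩
  map_one' := by ext <;> simp
  map_mul' a b := by
    ext
    · simp
    · simp [f.form_apply]

@[simp] theorem map_vec (f : SympSpace.Iso V U) (h : Heisenberg V) :
    (map f h).vec = f.toLinearEquiv h.vec := rfl
@[simp] theorem map_z (f : SympSpace.Iso V U) (h : Heisenberg V) : (map f h).z = h.z := rfl

theorem map_ofVec (f : SympSpace.Iso V U) (v : V) :
    map f (ofVec v) = ofVec (f.toLinearEquiv v) := rfl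

theorem map_ofCenter (f : SympSpace.Iso V U) (z : F) : map f (ofCenter z) = ofCenter z := by
  ext <;> simp [ofCenter]

theorem map_symm_map (f : SympSpace.Iso V U) (h : Heisenberg V) :
    map f.symm (map f h) = h := by
  ext
  · exact f.toLinearEquiv.symm_apply_apply _
  · rfl

theorem map_map_symm (f : SympSpace.Iso V U) (h : Heisenberg U) :
    map f (map f.symm h) = h := by
  ext
  · exact f.toLinearEquiv.apply_symm_apply _
  · rfl

end Heisenberg

/-! ## Oriented subspaces -/

/-- A subspace `I` of `V` with a nonzero vector of its top exterior power. The line `⋀^top I` is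
regarded as a line in the exterior algebra of `V`: it is spanned by the products of `dim I`
vectors of `I` (see `OrientedSubspace.top_eq_map`). -/
@[ext] structure OrientedSubspace (V : SympSpace.{w, u} F) where
  carrier : Submodule F V
  vec : ExteriorAlgebra F V
  vec_mem : vec ∈ (carrier.map (ExteriorAlgebra.ι F)) ^ finrank F carrier
  vec_ne_zero : vec ≠ 0

namespace OrientedSubspace

variable {V U W : SympSpace.{w, u} F}

/-- `⋀^d I`, mapped to the exterior algebra of `V` by the inclusion of `I`, is the submodule used
in the definition of an oriented subspace. -/
theorem top_eq_map (I : Submodule F V) (d : ℕ) :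
    (I.map (ExteriorAlgebra.ι F)) ^ d =
      (⋀[F]^d I).map (ExteriorAlgebra.map I.subtype).toLinearMap := by
  rw [Submodule.map_pow, ExteriorAlgebra.ι_range_map_map, Submodule.range_subtype]

theorem mem_exteriorPower (I : OrientedSubspace V) {n : ℕ} (h : finrank F I.carrier = n) :
    I.vec ∈ ⋀[F]^n V := by
  subst h
  exact pow_le_pow_left' (LinearMap.map_le_range (f := ExteriorAlgebra.ι F)) _ I.vec_mem

/-- The image `f(I°)` of an oriented subspace. -/
def map (f : SympSpace.Iso V U) (I : OrientedSubspace V) : OrientedSubspace U where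
  carrier := I.carrier.map (f.toLinearEquiv : V →ₗ[F] U)
  vec := ExteriorAlgebra.map (f.toLinearEquiv : V →ₗ[F] U) I.vec
  vec_mem := by
    rw [LinearEquiv.finrank_map_eq, ← Submodule.map_comp, ← ExteriorAlgebra.map_comp_ι,
      Submodule.map_comp, ← Submodule.map_pow]
    exact Submodule.mem_map_of_mem I.vec_mem
  vec_ne_zero h := I.vec_ne_zero <| by
    have h' := congrArg (ExteriorAlgebra.map (f.toLinearEquiv.symm : U →ₗ[F] V)) h
    rw [map_zero, ← AlgHom.comp_apply, ExteriorAlgebra.map_comp_map] at h'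
    simpa using h'

theorem map_trans (f : SympSpace.Iso V U) (g : SympSpace.Iso U W) (I : OrientedSubspace V) :
    I.map (f.trans g) = (I.map f).map g := by
  ext1
  · exact Submodule.map_comp (f.toLinearEquiv : V →ₗ[F] U) (g.toLinearEquiv : U →ₗ[F] W) I.carrier
  · change _ = ExteriorAlgebra.map _ (ExteriorAlgebra.map _ I.vec)
    rw [← AlgHom.comp_apply, ExteriorAlgebra.map_comp_map]
    rfl

theorem map_refl (I : OrientedSubspace V) : I.map (SympSpace.Iso.refl V) = I := by
  ext1
  · exact Submodule.map_id I.carrier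
  · change ExteriorAlgebra.map LinearMap.id I.vec = _
    simp

theorem map_symm_map (f : SympSpace.Iso V U) (I : OrientedSubspace V) :
    (I.map f).map f.symm = I := by
  rw [← map_trans]
  convert map_refl I
  exact SympSpace.Iso.toLinearEquiv_injective f.toLinearEquiv.self_trans_symm

theorem map_map_symm (f : SympSpace.Iso V U) (I : OrientedSubspace U) :
    (I.map f.symm).map f = I := map_symm_map f.symm I

/-- `I ⊆ I^⊥`. -/
def IsIsotropic (I : OrientedSubspace V) : Prop := I.carrier ≤ V.form.orthogonal I.carrier

/-- `L = L^⊥`. -/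
def IsLagrangian (L : OrientedSubspace V) : Prop := V.form.orthogonal L.carrier = L.carrier

end OrientedSubspace

theorem SympSpace.Iso.map_orthogonal {V U : SympSpace.{w, u} F} (f : SympSpace.Iso V U)
    (I : Submodule F V) :
    (V.form.orthogonal I).map (f.toLinearEquiv : V →ₗ[F] U) =
      U.form.orthogonal (I.map (f.toLinearEquiv : V →ₗ[F] U)) := by
  ext y
  constructor
  · rintro ⟨x, hx, rfl⟩ _ ⟨i, hi, rfl⟩
    exact (f.form_apply i x).trans (hx i hi)
  · intro hy
    refine ⟨f.toLinearEquiv.symm y, fun i hi => ?_, f.toLinearEquiv.apply_symm_apply y⟩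
    have := hy _ (Submodule.mem_map_of_mem hi)
    rw [← f.form_apply, LinearEquiv.apply_symm_apply]
    exact this

/-- The set `Lag°(V)` of oriented Lagrangian subspaces. -/
abbrev OrientedLagrangian (V : SympSpace.{w, u} F) :=
  {L : OrientedSubspace V // L.IsLagrangian}

/-- The oriented isotropic subspaces of `V`. -/
abbrev OrientedIsotropic (V : SympSpace.{w, u} F) :=
  {I : OrientedSubspace V // I.IsIsotropic}

namespace OrientedLagrangian

variable {V U : SympSpace.{w, u} F}

theorem finrank_eq (L : OrientedLagrangian V) :
    finrank F L.1.carrier = finrank F V / 2 := by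
  have h := LinearMap.BilinForm.finrank_orthogonal V.nondegenerate L.1.carrier
  rw [show V.form.orthogonal L.1.carrier = L.1.carrier from L.2] at h
  have := Submodule.finrank_le L.1.carrier
  omega

/-- The image of an oriented Lagrangian under a symplectic isomorphism. -/
def map (f : SympSpace.Iso V U) (L : OrientedLagrangian V) : OrientedLagrangian U :=
  ⟨L.1.map f, by
    have h : V.form.orthogonal L.1.carrier = L.1.carrier := L.2
    change U.form.orthogonal (L.1.carrier.map (f.toLinearEquiv : V →ₗ[F] U)) =
      L.1.carrier.map (f.toLinearEquiv : V →ₗ[F] U)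
    rw [← f.map_orthogonal, h]⟩

theorem map_map_symm (f : SympSpace.Iso V U) (L : OrientedLagrangian U) :
    (L.map f.symm).map f = L := Subtype.ext (OrientedSubspace.map_map_symm f L.1)

theorem map_symm_map (f : SympSpace.Iso V U) (L : OrientedLagrangian V) :
    (L.map f).map f.symm = L := Subtype.ext (OrientedSubspace.map_symm_map f L.1)

/-- The orientation, as an element of `⋀^n V` with `n = dim V / 2`. -/
def orientation (L : OrientedLagrangian V) : ⋀[F]^(finrank F V / 2) V :=
  ⟨L.1.vec, L.1.mem_exteriorPower L.finrank_eq⟩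

end OrientedLagrangian

/-! ## The models attached to oriented Lagrangians -/

section Models

variable (ψ : AddChar F ℂ) {V U : SympSpace.{w, u} F}

/-- The space `H_{L°}` of functions `f` on the Heisenberg group with `f (z * h) = ψ(z) f(h)` for
`z` in the center and `f (l * h) = f(h)` for `l` in `L`. -/
def lagModel (L : OrientedLagrangian V) : Submodule ℂ (Heisenberg V → ℂ) where
  carrier := {f | (∀ z h, f (Heisenberg.ofCenter z * h) = ψ z * f h) ∧
    ∀ l ∈ L.1.carrier, ∀ h, f (Heisenberg.ofVec l * h) = f h}
  zero_mem' := by simp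
  add_mem' := by
    rintro f g ⟨hf, hf'⟩ ⟨hg, hg'⟩
    refine ⟨fun z h => ?_, fun l hl h => ?_⟩
    · simp only [Pi.add_apply, hf, hg, mul_add]
    · simp only [Pi.add_apply, hf' l hl, hg' l hl]
  smul_mem' := by
    rintro c f ⟨hf, hf'⟩
    refine ⟨fun z h => ?_, fun l hl h => ?_⟩
    · simp only [Pi.smul_apply, hf, smul_eq_mul]; ring
    · simp only [Pi.smul_apply, hf' l hl]

/-- The Heisenberg action on `H_{L°}` by right translations. -/
def lagModelRep (L : OrientedLagrangian V) :
    Representation ℂ (Heisenberg V) (lagModel ψ L) where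
  toFun k :=
    { toFun := fun f => ⟨fun h => f.1 (h * k),
        fun z h => by simpa only [mul_assoc] using f.2.1 z (h * k),
        fun l hl h => by simpa only [mul_assoc] using f.2.2 l hl (h * k)⟩
      map_add' := fun _ _ => rfl
      map_smul' := fun _ _ => rfl }
  map_one' := by ext f h; simp
  map_mul' a b := by ext f h; simp [mul_assoc]

/-- The map `H_{L'°}(U) → H_{L°}(V)`, `φ ↦ φ ∘ f`, for `L'° = f(L°)`. -/
def pullback (f : SympSpace.Iso V U) (L : OrientedLagrangian V) (L' : OrientedLagrangian U)
    (h : L.map f = L') : lagModel ψ L' →ₗ[ℂ] lagModel ψ L where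
  toFun φ := ⟨fun x => φ.1 (Heisenberg.map f x),
    fun z x => by
      simpa only [map_mul, Heisenberg.map_ofCenter] using φ.2.1 z (Heisenberg.map f x),
    fun l hl x => by
      have hl' : f.toLinearEquiv l ∈ L'.1.carrier := by
        rw [← h]; exact Submodule.mem_map_of_mem hl
      simpa only [map_mul, Heisenberg.map_ofVec] using φ.2.2 _ hl' (Heisenberg.map f x)⟩
  map_add' _ _ := rfl
  map_smul' _ _ := rfl

theorem section_congr (v : ∀ L : OrientedLagrangian V, lagModel ψ L)
    {L L' : OrientedLagrangian V} (h : L = L') (x : Heisenberg V) : (v L).1 x = (v L').1 x := by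
  subst h; rfl

end Models

/-! ## The canonical system of intertwining morphisms -/

section Pairing

variable {V U : SympSpace.{w, u} F}

/-- The pairing `ω_∧` on `⋀^n V` induced by the symplectic form, with the sign convention
`ω_∧(l₁ ∧ … ∧ lₙ, m₁ ∧ … ∧ mₙ) = ω(lₙ, m₁) ω(lₙ₋₁, m₂) ⋯ ω(l₁, mₙ) ± …
  = (-1)^(n choose 2) det (ω(lᵢ, mⱼ))`.
For transversal Lagrangians this is the value of the volume form `ωⁿ / n!` on
`l₁ ∧ … ∧ lₙ ∧ m₁ ∧ … ∧ mₙ`. -/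
def wedgePairing (V : SympSpace.{w, u} F) (n : ℕ) (x y : ⋀[F]^n V) : F :=
  (-1) ^ n.choose 2 * exteriorPower.pairingDual F V n (exteriorPower.map n V.form x) y

theorem wedgePairing_map (f : SympSpace.Iso V U) (n : ℕ) (x y : ⋀[F]^n V) :
    wedgePairing U n (exteriorPower.map n (f.toLinearEquiv : V →ₗ[F] U) x)
      (exteriorPower.map n (f.toLinearEquiv : V →ₗ[F] U) y) = wedgePairing V n x y := by
  unfold wedgePairing
  congr 1
  have key : (exteriorPower.pairingDual F U n ∘ₗ exteriorPower.map n U.form ∘ₗ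
      exteriorPower.map n (f.toLinearEquiv : V →ₗ[F] U)).compl₂
      (exteriorPower.map n (f.toLinearEquiv : V →ₗ[F] U)) =
      exteriorPower.pairingDual F V n ∘ₗ exteriorPower.map n V.form := by
    apply exteriorPower.linearMap_ext
    ext a : 1
    apply exteriorPower.linearMap_ext
    ext b
    simp [exteriorPower.map_apply_ιMulti, f.form_apply, Function.comp_def]
  exact LinearMap.congr_fun₂ key x y

theorem coe_exteriorPower_map (f : V →ₗ[F] U) (n : ℕ) (x : ⋀[F]^n V) :
    (exteriorPower.map n f x : ExteriorAlgebra F U) = ExteriorAlgebra.map f x := by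
  have key : (⋀[F]^n U).subtype ∘ₗ exteriorPower.map n f =
      (ExteriorAlgebra.map f).toLinearMap ∘ₗ (⋀[F]^n V).subtype := by
    apply exteriorPower.linearMap_ext
    ext a
    simp [exteriorPower.map_apply_ιMulti, ExteriorAlgebra.map_apply_ιMulti]
  exact LinearMap.congr_fun key x

end Pairing

section Canonical

variable [Fintype F] [DecidableEq F] (ψ : AddChar F ℂ)

/-- The one dimensional Gauss sum. -/
def gaussSumOne : ℂ := ∑ z : F, ψ (2⁻¹ * z ^ 2)

variable {V U W : SympSpace.{w, u} F}

/-- The constant `C_{M°,L°} = (G₁ / q)^n σ((-1)^(n choose 2) ω_∧(o_L, o_M))`, with `n = dim V / 2`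
and `σ` the quadratic character of `F`. -/
def normConst (M L : OrientedLagrangian V) : ℂ :=
  (gaussSumOne ψ / (Fintype.card F : ℂ)) ^ (finrank F V / 2) *
    ((quadraticChar F ((-1) ^ (finrank F V / 2).choose 2 *
      wedgePairing V (finrank F V / 2) L.orientation M.orientation) : ℤ) : ℂ)

variable (V) in
/-- A system of linear maps `F_{M°,L°} : H_{L°} → H_{M°}`; the target index comes first. -/
abbrev LagSystem := ∀ M L : OrientedLagrangian V, lagModel ψ L →ₗ[ℂ] lagModel ψ M

/-- `S` is a canonical system of intertwining morphisms: its members commute with the Heisenberg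
action, are given by the normalized averaging morphisms for pairs in general position, and are
multiplicative. -/
structure IsCanonicalSystem (S : LagSystem ψ V) : Prop where
  intertwines : ∀ (M L : OrientedLagrangian V) (h : Heisenberg V),
    S M L ∘ₗ lagModelRep ψ L h = lagModelRep ψ M h ∘ₗ S M L
  restriction : ∀ M L : OrientedLagrangian V, L.1.carrier ⊓ M.1.carrier = ⊥ →
    ∀ (f : lagModel ψ L) (h : Heisenberg V),
      (S M L f).1 h = normConst ψ M L * ∑ᶠ m : M.1.carrier, f.1 (Heisenberg.ofVec m.1 * h)
  multiplicative : ∀ N M L : OrientedLagrangian V, S N L = S N M ∘ₗ S M L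

/-- The canonical vector space `H(V)`: the families `(v_{L°})` with `F_{M°,L°} v_{L°} = v_{M°}`
for the canonical system `F`. (There is exactly one canonical system.) -/
def canonicalSpace (V : SympSpace.{w, u} F) :
    Submodule ℂ (∀ L : OrientedLagrangian V, lagModel ψ L) where
  carrier := {v | ∀ S : LagSystem ψ V, IsCanonicalSystem ψ S → ∀ M L, S M L (v L) = v M}
  zero_mem' := fun S _ M L => by simp
  add_mem' := fun hv hw S hS M L => by simp [hv S hS M L, hw S hS M L]
  smul_mem' := fun c v hv S hS M L => by simp [hv S hS M L]

/-! ### Functoriality -/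

theorem normConst_map (f : SympSpace.Iso V U) (M L : OrientedLagrangian V) :
    normConst ψ (M.map f) (L.map f) = normConst ψ M L := by
  have hd : finrank F V = finrank F U := f.toLinearEquiv.finrank_eq
  have key : ∀ (n m : ℕ) (hn : n = m) (x y : ⋀[F]^n V) (x' y' : ⋀[F]^m U),
      ExteriorAlgebra.map (f.toLinearEquiv : V →ₗ[F] U) x.1 = x'.1 →
      ExteriorAlgebra.map (f.toLinearEquiv : V →ₗ[F] U) y.1 = y'.1 →
      wedgePairing U m x' y' = wedgePairing V n x y := by
    rintro n _ rfl x y x' y' hx hy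
    rw [← wedgePairing_map f]
    congr 1 <;> exact Subtype.ext (by rw [coe_exteriorPower_map]; symm; assumption)
  unfold normConst
  rw [key (finrank F V / 2) (finrank F U / 2) (by rw [hd]) L.orientation M.orientation
    (L.map f).orientation (M.map f).orientation rfl rfl]
  generalize wedgePairing V (finrank F V / 2) L.orientation M.orientation = c
  rw [hd]

/-- Transport of systems along a symplectic isomorphism. -/
def LagSystem.transport (f : SympSpace.Iso V U) (S : LagSystem ψ V) : LagSystem ψ U :=
  fun M L =>
    pullback ψ f.symm M (M.map f.symm) rfl ∘ₗ S (M.map f.symm) (L.map f.symm) ∘ₗ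
      pullback ψ f (L.map f.symm) L (L.map_map_symm f)

theorem IsCanonicalSystem.transport (f : SympSpace.Iso V U) {S : LagSystem ψ V}
    (hS : IsCanonicalSystem ψ S) : IsCanonicalSystem ψ (LagSystem.transport ψ f S) where
  intertwines M L h := by
    have hp : ∀ φ : lagModel ψ L,
        pullback ψ f (L.map f.symm) L (L.map_map_symm f) (lagModelRep ψ L h φ) =
        lagModelRep ψ (L.map f.symm) (Heisenberg.map f.symm h)
          (pullback ψ f (L.map f.symm) L (L.map_map_symm f) φ) := by
      intro φ
      ext x
      change φ.1 (Heisenberg.map f x * h) = φ.1 (Heisenberg.map f (x * Heisenberg.map f.symm h))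
      rw [map_mul, Heisenberg.map_map_symm]
    ext φ x
    have hi := LinearMap.congr_fun
      (hS.intertwines (M.map f.symm) (L.map f.symm) (Heisenberg.map f.symm h))
      (pullback ψ f (L.map f.symm) L (L.map_map_symm f) φ)
    simp only [LinearMap.comp_apply] at hi
    change (S _ _ (pullback ψ f _ L _ (lagModelRep ψ L h φ))).1 (Heisenberg.map f.symm x) =
      (S _ _ (pullback ψ f _ L _ φ)).1 (Heisenberg.map f.symm (x * h))
    rw [hp, hi, map_mul]
    rfl
  restriction M L hLM φ x := by
    have hb : (L.map f.symm).1.carrier ⊓ (M.map f.symm).1.carrier = ⊥ := by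
      change L.1.carrier.map (f.symm.toLinearEquiv : U →ₗ[F] V) ⊓
        M.1.carrier.map (f.symm.toLinearEquiv : U →ₗ[F] V) = ⊥
      rw [← Submodule.map_inf _ f.symm.toLinearEquiv.injective, hLM, Submodule.map_bot]
    have hr := hS.restriction _ _ hb (pullback ψ f (L.map f.symm) L (L.map_map_symm f) φ)
      (Heisenberg.map f.symm x)
    change (S _ _ (pullback ψ f _ L _ φ)).1 (Heisenberg.map f.symm x) = _
    rw [hr, normConst_map]
    congr 1
    refine (finsum_eq_of_bijective
      (f.symm.toLinearEquiv.submoduleMap M.1.carrier)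
      (f.symm.toLinearEquiv.submoduleMap M.1.carrier).bijective ?_).symm
    intro m
    change _ = φ.1 (Heisenberg.map f (Heisenberg.ofVec (f.symm.toLinearEquiv m.1) *
      Heisenberg.map f.symm x))
    rw [← Heisenberg.map_ofVec, ← map_mul, Heisenberg.map_map_symm]
  multiplicative N M L := by
    ext φ x
    change (S _ _ (pullback ψ f _ L _ φ)).1 (Heisenberg.map f.symm x) =
      (S _ _ (pullback ψ f _ M _ (pullback ψ f.symm M _ rfl (S _ _ (pullback ψ f _ L _ φ))))).1
        (Heisenberg.map f.symm x)
    have hc : ∀ χ : lagModel ψ (M.map f.symm),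
        pullback ψ f (M.map f.symm) M (M.map_map_symm f)
          (pullback ψ f.symm M (M.map f.symm) rfl χ) = χ := by
      intro χ
      ext y
      change χ.1 (Heisenberg.map f.symm (Heisenberg.map f y)) = _
      rw [Heisenberg.map_symm_map]
    rw [hc, hS.multiplicative _ (M.map f.symm) _]
    rfl

/-- The map `H(f) : H(U) → H(V)`, contravariant in the symplectic isomorphism `f : V → U`:
`(H(f) v)_{L°} (h) = v_{f(L°)} (f(h))`. -/
def canonicalMap (f : SympSpace.Iso V U) : canonicalSpace ψ U →ₗ[ℂ] canonicalSpace ψ V where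
  toFun v := ⟨fun L => pullback ψ f L (L.map f) rfl (v.1 (L.map f)), by
    intro S hS M L
    have h := v.2 _ (hS.transport ψ f) (M.map f) (L.map f)
    have hL := L.map_symm_map f
    have hM := M.map_symm_map f
    ext x
    change _ = (v.1 (M.map f)).1 (Heisenberg.map f x)
    rw [← h]
    change _ = (S _ _ (pullback ψ f _ _ _ (v.1 (L.map f)))).1
      (Heisenberg.map f.symm (Heisenberg.map f x))
    rw [Heisenberg.map_symm_map]
    have key : ∀ (L' M' : OrientedLagrangian V) (hL' : L' = L) (hM' : M' = M)
        (e : L'.map f = L.map f),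
        (S M L (pullback ψ f L (L.map f) rfl (v.1 (L.map f)))).1 x =
        (S M' L' (pullback ψ f L' (L.map f) e (v.1 (L.map f)))).1 x := by
      rintro _ _ rfl rfl _; rfl
    exact key _ _ hL hM _⟩
  map_add' _ _ := rfl
  map_smul' _ _ := rfl

/-- The representation `ρ_V` of `Sp(V)` on `H(V)`, `ρ_V(g) = H(g⁻¹)`. -/
def weilRep (V : SympSpace.{w, u} F) :
    Representation ℂ (SympSpace.Iso V V) (canonicalSpace ψ V) where
  toFun g := canonicalMap ψ g⁻¹
  map_one' := by
    ext v L x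
    exact section_congr ψ v.1 (Subtype.ext (OrientedSubspace.map_refl L.1)) x
  map_mul' g h := by
    ext v L x
    refine section_congr ψ v.1 (Subtype.ext ?_) _
    rw [mul_inv_rev]
    exact OrientedSubspace.map_trans g⁻¹ h⁻¹ L.1

/-- The action of the Heisenberg group on `H(V)`. -/
def heisenbergRep (V : SympSpace.{w, u} F) :
    Representation ℂ (Heisenberg V) (canonicalSpace ψ V) where
  toFun h :=
    { toFun := fun v => ⟨fun L => lagModelRep ψ L h (v.1 L), fun S hS M L => by
        have := LinearMap.congr_fun (hS.intertwines M L h) (v.1 L)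
        simp only [LinearMap.comp_apply] at this
        rw [this, v.2 S hS M L]⟩
      map_add' := fun _ _ => by ext; simp
      map_smul' := fun _ _ => by ext; simp }
  map_one' := by ext; simp
  map_mul' a b := by ext; simp

/-- `H(V)^I`: the vectors of `H(V)` fixed by the elements `(i, 0)`, `i ∈ I`. -/
def invariantVectors (I : OrientedIsotropic V) : Submodule ℂ (canonicalSpace ψ V) where
  carrier := {v | ∀ i ∈ I.1.carrier, heisenbergRep ψ V (Heisenberg.ofVec i) v = v}
  zero_mem' := by simp
  add_mem' := fun hv hw i hi => by rw [map_add, hv i hi, hw i hi]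
  smul_mem' := fun c v hv i hi => by rw [map_smul, hv i hi]

theorem canonicalMap_mem (f : SympSpace.Iso V U) {I : OrientedIsotropic V}
    {J : OrientedIsotropic U} (h : I.1.map f = J.1) {v : canonicalSpace ψ U}
    (hv : v ∈ invariantVectors ψ J) : canonicalMap ψ f v ∈ invariantVectors ψ I := by
  intro i hi
  have hfi : f.toLinearEquiv i ∈ J.1.carrier := by
    rw [← h]; exact Submodule.mem_map_of_mem hi
  have := hv _ hfi
  ext L x
  change (v.1 (L.map f)).1 (Heisenberg.map f (x * Heisenberg.ofVec i)) =
    (v.1 (L.map f)).1 (Heisenberg.map f x)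
  rw [map_mul, Heisenberg.map_ofVec]
  exact congrArg (fun t : canonicalSpace ψ U => (t.1 (L.map f)).1 (Heisenberg.map f x)) this

/-- The restriction `H(U)^J → H(V)^I` of `H(f)`, for `f(I°) = J°`. -/
def invariantMap (f : SympSpace.Iso V U) {I : OrientedIsotropic V} {J : OrientedIsotropic U}
    (h : I.1.map f = J.1) : invariantVectors ψ J →ₗ[ℂ] invariantVectors ψ I :=
  (canonicalMap ψ f).restrict fun _ hv => canonicalMap_mem ψ f h hv

end Canonical

/-! ## Symplectic reduction -/

namespace OrientedIsotropic

variable {V U : SympSpace.{w, u} F}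

/-- `I^⊥`. -/
abbrev perp (I : OrientedIsotropic V) : Submodule F V := V.form.orthogonal I.1.carrier

/-- `I` as a subspace of `I^⊥`. -/
abbrev inPerp (I : OrientedIsotropic V) : Submodule F I.perp :=
  I.1.carrier.submoduleOf I.perp

theorem inPerp_le_ker (I : OrientedIsotropic V) :
    I.inPerp ≤ LinearMap.ker (V.form.restrict I.perp) := by
  intro x hx
  ext y
  exact y.2 x.1 hx

theorem inPerp_le_ker_flip (I : OrientedIsotropic V) :
    I.inPerp ≤ LinearMap.ker (V.form.restrict I.perp).flip := by
  intro x hx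
  ext y
  exact V.isAlt.isRefl _ _ (y.2 x.1 hx)

/-- The symplectic reduction `I^⊥ / I`, with the form induced by that of `V`. -/
def reduction (I : OrientedIsotropic V) : SympSpace.{w, u} F where
  carrier := I.perp ⧸ I.inPerp
  form := LinearMap.liftQ₂ I.inPerp I.inPerp (V.form.restrict I.perp)
    I.inPerp_le_ker I.inPerp_le_ker_flip
  isAlt := by
    intro x
    obtain ⟨x, rfl⟩ := Submodule.Quotient.mk_surjective _ x
    exact V.isAlt x.1
  nondegenerate := by
    have hsep : ∀ x : I.perp, (∀ y : I.perp, V.form x.1 y.1 = 0) → x ∈ I.inPerp := by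
      intro x hx
      have h : x.1 ∈ V.form.orthogonal (V.form.orthogonal I.1.carrier) :=
        fun y hy => V.isAlt.isRefl _ _ (hx ⟨y, hy⟩)
      rwa [LinearMap.BilinForm.orthogonal_orthogonal V.nondegenerate V.isAlt.isRefl] at h
    constructor
    · intro x hx
      obtain ⟨x, rfl⟩ := Submodule.Quotient.mk_surjective _ x
      exact (Submodule.Quotient.mk_eq_zero _).2
        (hsep x fun y => hx (Submodule.Quotient.mk y))
    · intro x hx
      obtain ⟨x, rfl⟩ := Submodule.Quotient.mk_surjective _ x
      exact (Submodule.Quotient.mk_eq_zero _).2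
        (hsep x fun y => V.isAlt.isRefl _ _ (hx (Submodule.Quotient.mk y)))

theorem map_perp (f : SympSpace.Iso V U) {I : OrientedIsotropic V} {J : OrientedIsotropic U}
    (h : I.1.map f = J.1) : I.perp.map (f.toLinearEquiv : V →ₗ[F] U) = J.perp := by
  rw [f.map_orthogonal, perp, ← h]
  rfl

/-- The isomorphism `I^⊥ → J^⊥` induced by `f` with `f(I°) = J°`. -/
def perpEquiv (f : SympSpace.Iso V U) {I : OrientedIsotropic V} {J : OrientedIsotropic U}
    (h : I.1.map f = J.1) : I.perp ≃ₗ[F] J.perp :=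
  f.toLinearEquiv.ofSubmodules I.perp J.perp (map_perp f h)

theorem map_inPerp (f : SympSpace.Iso V U) {I : OrientedIsotropic V} {J : OrientedIsotropic U}
    (h : I.1.map f = J.1) :
    I.inPerp.map (perpEquiv f h : I.perp →ₗ[F] J.perp) = J.inPerp := by
  ext y
  constructor
  · rintro ⟨x, hx, rfl⟩
    change f.toLinearEquiv x.1 ∈ J.1.carrier
    rw [← h]
    exact Submodule.mem_map_of_mem hx
  · intro hy
    have hy' : y.1 ∈ J.1.carrier := hy
    rw [← h] at hy'
    obtain ⟨x, hx, hxy⟩ := hy'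
    exact ⟨⟨x, I.2 hx⟩, hx, Subtype.ext hxy⟩

/-- The isomorphism `f_I : I^⊥ / I → J^⊥ / J` induced by `f` with `f(I°) = J°`. -/
def reductionIso (f : SympSpace.Iso V U) {I : OrientedIsotropic V} {J : OrientedIsotropic U}
    (h : I.1.map f = J.1) : SympSpace.Iso I.reduction J.reduction where
  toLinearEquiv := Submodule.Quotient.equiv I.inPerp J.inPerp (perpEquiv f h) (map_inPerp f h)
  map_form x y := by
    obtain ⟨x, rfl⟩ := Submodule.Quotient.mk_surjective _ x
    obtain ⟨y, rfl⟩ := Submodule.Quotient.mk_surjective _ y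
    exact f.form_apply x.1 y.1

/-- The group `P` of all `g` in `Sp(V)` with `g(I°) = I°`. -/
def stabilizer (I : OrientedIsotropic V) : Subgroup (SympSpace.Iso V V) where
  carrier := {g | I.1.map g = I.1}
  one_mem' := OrientedSubspace.map_refl I.1
  mul_mem' := fun {g k} hg hk => by
    change I.1.map (k.trans g) = I.1
    rw [OrientedSubspace.map_trans, show I.1.map k = I.1 from hk]
    exact hg
  inv_mem' := fun {g} hg => by
    change I.1.map g.symm = I.1
    conv_lhs => rw [← show I.1.map g = I.1 from hg]
    exact OrientedSubspace.map_symm_map g I.1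

/-- The canonical homomorphism `P → Sp(I^⊥ / I)`. -/
def stabilizerHom (I : OrientedIsotropic V) :
    I.stabilizer →* SympSpace.Iso I.reduction I.reduction where
  toFun g := reductionIso g.1 g.2
  map_one' := by
    apply SympSpace.Iso.toLinearEquiv_injective
    ext x
    obtain ⟨x, rfl⟩ := Submodule.Quotient.mk_surjective _ x
    rfl
  map_mul' g k := by
    apply SympSpace.Iso.toLinearEquiv_injective
    ext x
    obtain ⟨x, rfl⟩ := Submodule.Quotient.mk_surjective _ x
    rfl

end OrientedIsotropic

/-- The subspace `H(V)^I` as a subrepresentation of the restriction of `ρ_V` to `P`. -/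
def invariantSubrep [Fintype F] [DecidableEq F] (ψ : AddChar F ℂ) {V : SympSpace.{w, u} F}
    (I : OrientedIsotropic V) :
    Subrepresentation ((weilRep ψ V).comp I.stabilizer.subtype) where
  toSubmodule := invariantVectors ψ I
  apply_mem_toSubmodule g _ hv := canonicalMap_mem ψ _ (I.stabilizer.inv_mem g.2) hv

end

/-! ## Quadratic Gauss sums over a finite field -/

/-! An intertwining map from `H_K` to `H_L` is determined by one number, its value on the delta
function of `K` evaluated at `1` (`intertwiner_ext`). Every identity between intertwiners therefore
reduces to an identity of numbers.

To construct the canonical system, take a Lagrangian `N` transversal to both `K` and `L` and compose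
the two normalized averagings through `N`. The number attached to this composition is `q^(-n) σ(c) ∑
ψ(ω(k, P k) / 2)`, the sum running over `k` in `K`, where `P` is the projection onto `L` along `N`
and `P o_K = c o_L` (`averaging_averaging_lagDelta`). It is independent of `N`, because `P` may be
replaced by any `T` that maps `K` onto `L`, fixes `K ∩ L` and makes `ω(x, T y)` symmetric on `K`.
Two such maps differ by an automorphism `A` of `K` that is the identity on the radical of the form,
and passing from one to the other multiplies both the Gauss sum and `σ(c)` by `σ(det A)`
(`sum_addChar_twist`, `Transfers.sign_mul_sum_eq`). The choice `T = id` gives `F_{K,K} = id`. Since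
`q ≥ 3`, any three Lagrangians have a common transversal, and multiplicativity and uniqueness
follow.

For the reduction, a Lagrangian `L` of `I^⊥ / I` is lifted to its preimage in `I^⊥`, oriented by
`o_I ∧ o_L`. The functions in the lifted model that are invariant under `I` are supported on `I^⊥ ×
F` and inflated from `H(I^⊥ / I)`, so `α` restricts the component at the lifted Lagrangian. A
transfer downstairs lifts with the same `c`; its Gauss sum grows by `q^(dim I)`, exactly as `q^n`
does. The two canonical systems are therefore compatible
(`restrictModel_canonicalSystem_extendModel`). The restriction uses a noncanonical linear section of
`I^⊥ → I^⊥ / I`, but a change of section is invisible: wedging with `o_I` kills its effect on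
orientations, and invariance under `I` kills its effect on values. This gives naturality, and
equivariance under `P` is naturality for automorphisms. -/

section Gauss

variable {F : Type w} [Field F] [Fintype F] [DecidableEq F]

variable (F) in
/-- The quadratic character with complex values. -/
noncomputable def quadSign : MulChar F ℂ := (quadraticChar F).ringHomComp (Int.castRingHom ℂ)

theorem quadSign_apply (a : F) : quadSign F a = ((quadraticChar F a : ℤ) : ℂ) := rfl

theorem quadSign_mul_self {a : F} (ha : a ≠ 0) : quadSign F a * quadSign F a = 1 := by
  rw [quadSign_apply, ← Int.cast_mul, ← sq, quadraticChar_sq_one ha, Int.cast_one]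

theorem quadSign_ne_one (hF : ringChar F ≠ 2) : quadSign F ≠ 1 := by
  obtain ⟨a, ha⟩ := quadraticChar_exists_neg_one' hF
  intro h
  have h1 := congrArg (fun χ : MulChar F ℂ => χ a) h
  simp only [quadSign_apply, ha, MulChar.one_apply_coe] at h1
  norm_num at h1

theorem quadSign_isQuadratic : (quadSign F).IsQuadratic :=
  (quadraticChar_isQuadratic F).comp _

theorem addChar_map_sum {F : Type*} [Field F] (ψ : AddChar F ℂ) {ι : Type*} (s : Finset ι) (f : ι → F) :
    ψ (∑ i ∈ s, f i) = ∏ i ∈ s, ψ (f i) := by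
  classical
  induction s using Finset.induction_on with
  | empty => simp
  | insert a s ha ih => rw [Finset.sum_insert ha, Finset.prod_insert ha, AddChar.map_add_eq_mul, ih]

-- The form involves only the coordinates in `p`; each remaining coordinate is free and contributes
-- a factor `q`.
open Matrix in
theorem sum_addChar_block {F : Type*} [Field F] [Fintype F] (ψ : AddChar F ℂ) {ι : Type*} [Fintype ι] [DecidableEq ι] (p : ι → Prop) [DecidablePred p]
    (N : Matrix ι ι F) (hN : ∀ i j, ¬ (p i ∧ p j) → N i j = 0) :
    ∑ x : ι → F, ψ (2⁻¹ * x ⬝ᵥ N.mulVec x) =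
      (Fintype.card F : ℂ) ^ Fintype.card {i // ¬ p i} *
        ∑ y : {i // p i} → F, ψ (2⁻¹ * y ⬝ᵥ (N.toSquareBlockProp p).mulVec y) := by
  have key : ∀ x : ι → F, x ⬝ᵥ N.mulVec x =
      (fun i : {i // p i} => x i) ⬝ᵥ (N.toSquareBlockProp p).mulVec (fun i => x i) := by
    intro x
    simp only [dotProduct, mulVec, toSquareBlockProp_def, of_apply]
    have hout : ∀ f : ι → F, (∀ i, ¬ p i → f i = 0) → ∑ i, f i = ∑ i : {i // p i}, f i := by
      intro f hf
      rw [← Fintype.sum_subtype_add_sum_subtype p f,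
        Fintype.sum_eq_zero (fun i : {i // ¬ p i} => f i) fun i => hf i.1 i.2, add_zero]
    rw [hout _ fun i hi => by
      rw [Finset.sum_eq_zero fun j _ => by rw [hN i j fun h => hi h.1, zero_mul], mul_zero]]
    refine Finset.sum_congr rfl fun i _ => ?_
    rw [hout _ fun j hj => by rw [hN i j fun h => hj h.2, zero_mul]]
  rw [Fintype.sum_equiv (Equiv.piEquivPiSubtypeProd p fun _ => F) _
    (fun z => ψ (2⁻¹ * z.1 ⬝ᵥ (N.toSquareBlockProp p).mulVec z.1)) fun x => by rw [key]; rfl,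
    Fintype.sum_prod_type]
  simp [Finset.mul_sum]

variable (ψ : AddChar F ℂ)

/-- An element `t` has `1 + σ(t)` square roots, and the part without `σ` sums to zero because the
shifted character is nontrivial. -/
theorem sum_addChar_mul_sq (hF : ringChar F ≠ 2) (hψ : ψ ≠ 1) {w : F} (hw : w ≠ 0) :
    ∑ z : F, ψ (w * z ^ 2) = gaussSum (quadSign F) (ψ.mulShift w) := by
  have hp : (ψ.mulShift w) ≠ 0 := (AddChar.IsPrimitive.of_ne_one hψ) hw
  have hfib : ∑ z : F, ψ (w * z ^ 2) =
      ∑ t : F, ∑ z : F with z ^ 2 = t, ψ (w * z ^ 2) :=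
    (Finset.sum_fiberwise _ _ _).symm
  rw [hfib, gaussSum]
  have : ∀ t : F, ∑ z : F with z ^ 2 = t, ψ (w * z ^ 2) =
      quadSign F t * ψ.mulShift w t + ψ.mulShift w t := by
    intro t
    have h1 : ∀ z ∈ Finset.univ.filter (fun z : F => z ^ 2 = t), ψ (w * z ^ 2) = ψ (w * t) := by
      intro z hz; rw [(Finset.mem_filter.1 hz).2]
    rw [Finset.sum_congr rfl h1, Finset.sum_const, nsmul_eq_mul, AddChar.mulShift_apply,
      quadSign_apply]
    have h2 := quadraticChar_card_sqrts hF t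
    have h3 : (Finset.univ.filter (fun z : F => z ^ 2 = t)) = {x : F | x ^ 2 = t}.toFinset := by
      ext; simp
    have h4 : ((Finset.univ.filter (fun z : F => z ^ 2 = t)).card : ℂ) =
        ((quadraticChar F t + 1 : ℤ) : ℂ) := by
      rw [h3, ← h2, Int.cast_natCast]
    rw [h4]; push_cast; ring
  rw [Finset.sum_congr rfl fun t _ => this t, Finset.sum_add_distrib,
    AddChar.sum_eq_zero_of_ne_one hp, add_zero]

theorem gaussSumOne_eq (hF : ringChar F ≠ 2) (hψ : ψ ≠ 1) :
    gaussSumOne ψ = gaussSum (quadSign F) (ψ.mulShift 2⁻¹) :=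
  sum_addChar_mul_sq ψ hF hψ (inv_ne_zero (Ring.two_ne_zero hF))

theorem sum_addChar_half_mul_sq (hF : ringChar F ≠ 2) (hψ : ψ ≠ 1) {w : F} (hw : w ≠ 0) :
    ∑ z : F, ψ (2⁻¹ * (w * z ^ 2)) = quadSign F w * gaussSumOne ψ := by
  have h2 := Ring.two_ne_zero hF
  have h := sum_addChar_mul_sq ψ hF hψ (w := 2⁻¹ * w) (mul_ne_zero (inv_ne_zero h2) hw)
  simp only [mul_assoc] at h
  rw [h, gaussSumOne_eq ψ hF hψ]
  have := gaussSum_mulShift (quadSign F) (ψ.mulShift 2⁻¹) (Units.mk0 w hw)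
  rw [AddChar.mulShift_mulShift, Units.val_mk0] at this
  rw [← this, ← mul_assoc, quadSign_mul_self hw, one_mul]

theorem gaussSumOne_sq (hF : ringChar F ≠ 2) (hψ : ψ ≠ 1) :
    gaussSumOne ψ ^ 2 = quadSign F (-1) * Fintype.card F := by
  rw [gaussSumOne_eq ψ hF hψ]
  refine gaussSum_sq (quadSign_ne_one hF) quadSign_isQuadratic ?_
  exact AddChar.IsPrimitive.of_ne_one
    ((AddChar.IsPrimitive.of_ne_one hψ) (inv_ne_zero (Ring.two_ne_zero hF)))

/-- The Gauss sum of a nondegenerate quadratic form. -/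
theorem sum_addChar_quadratic {ι : Type*} [Fintype ι] [DecidableEq ι] (hF : ringChar F ≠ 2)
    (hψ : ψ ≠ 1) (M : Matrix ι ι F) (hM : M.IsSymm) (hdet : M.det ≠ 0) :
    ∑ x : ι → F, ψ (2⁻¹ * x ⬝ᵥ M.mulVec x) =
      quadSign F M.det * gaussSumOne ψ ^ Fintype.card ι := by
  have h2 := Ring.two_ne_zero hF
  let _ : Invertible (2 : F) := invertibleOfNonzero h2
  have hS : LinearMap.IsSymm (Matrix.toBilin' M) := ⟨fun x y => by
    simp only [Matrix.toBilin'_apply', RingHom.id_apply]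
    rw [Matrix.dotProduct_mulVec, ← Matrix.mulVec_transpose, hM, dotProduct_comm]⟩
  obtain ⟨v₀, hv₀⟩ := LinearMap.BilinForm.exists_orthogonal_basis hS
  let v : Basis ι F (ι → F) := v₀.reindex (Fintype.equivOfCardEq (by simp))
  have hv : ∀ i j, i ≠ j → v i ⬝ᵥ M.mulVec (v j) = 0 := by
    intro i j hij
    have := hv₀ (i := (Fintype.equivOfCardEq (by simp) : Fin _ ≃ ι).symm i)
      (j := (Fintype.equivOfCardEq (by simp) : Fin _ ≃ ι).symm j) (by simpa using hij)
    simp only [Function.onFun, Matrix.toBilin'_apply'] at this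
    simpa [v] using this
  let P : Matrix ι ι F := Matrix.of fun i j => v j i
  have hP : IsUnit P.det := by
    have := (Pi.basisFun F ι).isUnit_det v
    rw [Basis.det_apply] at this
    exact this
  let d : ι → F := fun i => v i ⬝ᵥ M.mulVec (v i)
  have hD : P.transpose * M * P = Matrix.diagonal d := by
    ext i j
    have h1 : (P.transpose * M * P) i j = v i ⬝ᵥ M.mulVec (v j) := by
      rw [mul_assoc]
      simp only [Matrix.mul_apply, Matrix.transpose_apply, dotProduct, Matrix.mulVec, P,
        Matrix.of_apply]
    rw [h1]
    by_cases hij : i = j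
    · subst hij; simp [d]
    · rw [hv i j hij, Matrix.diagonal_apply_ne _ hij]
  have hdetD : P.det * M.det * P.det = ∏ i, d i := by
    rw [← Matrix.det_diagonal, ← hD, Matrix.det_mul, Matrix.det_mul, Matrix.det_transpose]
  have hd : ∀ i, d i ≠ 0 := by
    have : ∏ i, d i ≠ 0 := by
      rw [← hdetD]
      exact mul_ne_zero (mul_ne_zero hP.ne_zero hdet) hP.ne_zero
    exact fun i => (Finset.prod_ne_zero_iff.1 this) i (Finset.mem_univ i)
  -- The substitution `x = P y` diagonalizes the form, and the sum becomes a product of one-variable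
  -- Gauss sums.
  have hsub : ∑ x : ι → F, ψ (2⁻¹ * x ⬝ᵥ M.mulVec x) =
      ∑ y : ι → F, ψ (2⁻¹ * (P.mulVec y) ⬝ᵥ M.mulVec (P.mulVec y)) := by
    refine (Fintype.sum_equiv
      (Matrix.toLinearEquiv' P (P.invertibleOfIsUnitDet hP)).toEquiv _ _ fun y => ?_).symm
    rfl
  have hq : ∀ y : ι → F, 2⁻¹ * (P.mulVec y) ⬝ᵥ M.mulVec (P.mulVec y) =
      ∑ i, 2⁻¹ * (d i * y i ^ 2) := by
    intro y
    have : (P.mulVec y) ⬝ᵥ M.mulVec (P.mulVec y) = y ⬝ᵥ (P.transpose * M * P).mulVec y := by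
      rw [← Matrix.mulVec_mulVec, ← Matrix.mulVec_mulVec, Matrix.dotProduct_mulVec y,
        Matrix.vecMul_transpose]
    rw [this, hD, ← Finset.mul_sum]
    congr 1
    simp only [dotProduct, Matrix.mulVec_diagonal]
    exact Finset.sum_congr rfl fun i _ => by ring
  rw [hsub]
  simp only [hq, addChar_map_sum]
  rw [← Fintype.piFinset_univ]
  rw [← Finset.prod_univ_sum (fun _ : ι => (Finset.univ : Finset F))
    (fun i z => ψ (2⁻¹ * (d i * z ^ 2)))]
  simp only [sum_addChar_half_mul_sq ψ hF hψ (hd _), Finset.prod_mul_distrib, Finset.prod_const,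
    Finset.card_univ]
  congr 1
  -- The change of basis enters through `det P` twice, so its sign disappears.
  rw [← map_prod, ← hdetD, map_mul, map_mul]
  linear_combination (quadSign F) M.det * quadSign_mul_self hP.ne_zero


/-- Twisting the Gauss sum of a possibly degenerate quadratic form by an automorphism. -/
theorem sum_addChar_twist {K : Type*} [AddCommGroup K] [Module F K] [FiniteDimensional F K]
    [Fintype K] (hF : ringChar F ≠ 2) (hψ : ψ ≠ 1) (B : LinearMap.BilinForm F K)
    (hB : ∀ x y, B x y = B y x) (A : K →ₗ[F] K) (hA : LinearMap.det A ≠ 0)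
    (hBA : ∀ x y, B x (A y) = B y (A x)) (hrad : ∀ x, (∀ y, B x y = 0) → A x = x) :
    ∑ x, ψ (2⁻¹ * B x (A x)) = quadSign F (LinearMap.det A) * ∑ x, ψ (2⁻¹ * B x x) := by
  let _ : Invertible (2 : F) := invertibleOfNonzero (Ring.two_ne_zero hF)
  obtain ⟨v, hv⟩ := LinearMap.BilinForm.exists_orthogonal_basis
    (show LinearMap.IsSymm B from ⟨fun x y => hB x y⟩)
  have hv' : ∀ i j, i ≠ j → B (v i) (v j) = 0 := fun i j hij => hv hij
  let b : Fin (finrank F K) → F := fun i => B (v i) (v i)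
  -- In a basis orthogonal for `B`, the indices outside `p` give vectors of the radical, which `A`
  -- fixes. So `A` is block triangular with an identity block, and `det A` is the determinant of the
  -- block on `p`, where `B` is nondegenerate.
  let p : Fin (finrank F K) → Prop := fun i => b i ≠ 0
  let a := LinearMap.toMatrix v v A
  have hBv : ∀ i x, B (v i) x = b i * v.repr x i := by
    intro i x
    conv_lhs => rw [← v.sum_repr x]
    rw [map_sum, Finset.sum_eq_single i]
    · simp [b, mul_comm]
    · intro j _ hj
      rw [map_smul, hv' i j hj.symm, smul_zero]
    · simp
  have ha : ∀ i j, ¬ p j → a i j = if i = j then 1 else 0 := by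
    intro i j hj
    have h0 : b j = 0 := not_not.1 hj
    have : A (v j) = v j := hrad _ fun y => by rw [hBv, h0, zero_mul]
    simp only [a, LinearMap.toMatrix_apply, this, v.repr_self, Finsupp.single_apply]
    simp only [eq_comm]
  have hBx : ∀ (C : K →ₗ[F] K) (x : K), B x (C x) =
      (v.equivFun x) ⬝ᵥ (Matrix.diagonal b * LinearMap.toMatrix v v C).mulVec (v.equivFun x) := by
    intro C x
    conv_lhs => rw [← v.sum_repr x]
    rw [map_sum, LinearMap.sum_apply, v.sum_repr]
    refine Finset.sum_congr rfl fun i _ => ?_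
    rw [map_smul, LinearMap.smul_apply, hBv, smul_eq_mul, ← Matrix.mulVec_mulVec,
      Matrix.mulVec_diagonal]
    congr 2
    exact (congrFun (LinearMap.toMatrix_mulVec_repr v v C x) i).symm
  have hsum : ∀ C : K →ₗ[F] K, ∑ x, ψ (2⁻¹ * B x (C x)) = ∑ x : Fin (finrank F K) → F,
      ψ (2⁻¹ * x ⬝ᵥ (Matrix.diagonal b * LinearMap.toMatrix v v C).mulVec x) := fun C =>
    Fintype.sum_equiv v.equivFun.toEquiv _ _ fun x => by rw [hBx]; rfl
  have hsum1 := hsum LinearMap.id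
  simp only [LinearMap.id_apply, LinearMap.toMatrix_id, mul_one] at hsum1
  rw [hsum A, hsum1]
  rw [sum_addChar_block ψ p, sum_addChar_block ψ p]
  rotate_left
  · intro i j h
    by_cases hij : i = j
    · subst hij
      rw [Matrix.diagonal_apply_eq]
      exact not_not.1 fun hp => h ⟨hp, hp⟩
    · exact Matrix.diagonal_apply_ne _ hij
  · intro i j h
    rw [Matrix.diagonal_mul]
    by_cases hi : p i
    · have hj : ¬ p j := fun hj => h ⟨hi, hj⟩
      change b i * a i j = 0
      rw [ha i j hj, if_neg (show ¬ i = j from fun e => hj (e ▸ hi)), mul_zero]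
    · rw [not_not.1 hi, zero_mul]
  have hblock : (Matrix.diagonal b * a).toSquareBlockProp p =
      Matrix.diagonal (fun i : {i // p i} => b i) * a.toSquareBlockProp p := by
    ext i j
    simp [Matrix.toSquareBlockProp_def, Matrix.diagonal_mul]
  have hblock1 : (Matrix.diagonal b).toSquareBlockProp p =
      Matrix.diagonal (fun i : {i // p i} => b i) := by
    ext i j
    simp [Matrix.toSquareBlockProp_def, Matrix.diagonal_apply, Subtype.ext_iff]
  have hdet : LinearMap.det A = (a.toSquareBlockProp p).det := by
    rw [← LinearMap.det_toMatrix v A, Matrix.twoBlockTriangular_det' _ p]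
    · have : a.toSquareBlockProp (fun i => ¬ p i) = 1 := by
        ext i j
        rw [Matrix.toSquareBlockProp_def, Matrix.of_apply, ha _ _ j.2, Matrix.one_apply]
        simp [Subtype.ext_iff]
      change _ * (a.toSquareBlockProp _).det = _
      rw [this, Matrix.det_one, mul_one]
    · intro i hi j hj
      change a i j = 0
      rw [ha i j hj, if_neg (show ¬ i = j from fun e => hj (e ▸ hi))]
  have hb : ∏ i : {i // p i}, b i ≠ 0 := Finset.prod_ne_zero_iff.2 fun i _ => i.2
  change _ * ∑ y : {i // p i} → F,
    ψ (2⁻¹ * y ⬝ᵥ ((Matrix.diagonal b * a).toSquareBlockProp p).mulVec y) = _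
  rw [sum_addChar_quadratic ψ hF hψ _ _ _, sum_addChar_quadratic ψ hF hψ _ _ _, hblock, hblock1,
    Matrix.det_mul, Matrix.det_diagonal, hdet, map_mul]
  · ring
  · rw [hblock1]; exact Matrix.isSymm_diagonal _
  · rw [hblock1, Matrix.det_diagonal]; exact hb
  · ext i j
    have h := hBA (v i) (v j)
    rw [hBv, hBv] at h
    simp only [Matrix.transpose_apply, Matrix.toSquareBlockProp_def, Matrix.of_apply,
      Matrix.diagonal_mul, a, LinearMap.toMatrix_apply]
    exact h.symm
  · rw [hblock, Matrix.det_mul, Matrix.det_diagonal, ← hdet]; exact mul_ne_zero hb hA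

end Gauss

/-! ## Top exterior powers -/

section TopPower

variable {F : Type w} [Field F]

/-- An alternating map in as many variables as the dimension is fixed by its value on one basis; a
permutation of that basis produces the same sign on both sides. -/
theorem AlternatingMap.apply_eq_det_smul {ι M N : Type*} [Fintype ι] [DecidableEq ι]
    [AddCommGroup M] [Module F M] [AddCommGroup N] [Module F N] (e : Basis ι F M)
    (f : M [⋀^ι]→ₗ[F] N) (v : ι → M) : f v = e.det v • f e := by
  have : f = (LinearMap.toSpanSingleton F N (f e)).compAlternatingMap e.det := by
    refine Basis.ext_alternating e fun i h => ?_
    let σ : Equiv.Perm ι := Equiv.ofBijective i (Finite.injective_iff_bijective.1 h)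
    change f (e ∘ σ) = e.det (e ∘ σ) • f e
    rw [AlternatingMap.map_perm, AlternatingMap.map_perm, Basis.det_self, smul_assoc, one_smul]
  conv_lhs => rw [this]
  rfl

theorem Module.Basis.coe_sum_repr {ι M : Type*} [Fintype ι] [AddCommGroup M] [Module F M]
    {I : Submodule F M} (b : Basis ι F I) (x : I) : ∑ i, b.repr x i • (b i : M) = x := by
  have := congrArg Subtype.val (b.sum_repr x)
  simpa only [AddSubmonoidClass.coe_finsetSum, Submodule.coe_smul] using this

theorem ExteriorAlgebra.ιMulti_ne_zero {M : Type*} [AddCommGroup M] [Module F M] {n : ℕ}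
    {v : Fin n → M} (hv : LinearIndependent F v) : ExteriorAlgebra.ιMulti F n v ≠ 0 := by
  have h := (exteriorPower.ιMulti_family_linearIndependent_field (n := n) hv).ne_zero
    (Set.powersetCard.ofFinEmbEquiv (RelEmbedding.refl _))
  intro h0
  apply h
  ext
  simpa [exteriorPower.ιMulti_family, ExteriorAlgebra.ιMulti_family] using h0

variable {V U : SympSpace.{w, u} F}

namespace OrientedSubspace

theorem exists_smul_ιMulti {I : Submodule F V} {n : ℕ} (b : Basis (Fin n) F I)
    {x : ExteriorAlgebra F V} (hx : x ∈ (I.map (ExteriorAlgebra.ι F)) ^ n) :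
    ∃ a : F, x = a • ExteriorAlgebra.ιMulti F n fun i => (b i : V) := by
  rw [top_eq_map] at hx
  obtain ⟨y, hy, rfl⟩ := hx
  rw [← ExteriorAlgebra.ιMulti_span_fixedDegree] at hy
  have : Submodule.span F (Set.range (ExteriorAlgebra.ιMulti F n (M := I))) ≤
      Submodule.span F {ExteriorAlgebra.ιMulti F n (b : Fin n → I)} := by
    rw [Submodule.span_le]
    rintro _ ⟨v, rfl⟩
    rw [AlternatingMap.apply_eq_det_smul b (ExteriorAlgebra.ιMulti F n) v]
    exact Submodule.mem_span_singleton.2 ⟨_, rfl⟩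
  obtain ⟨a, ha⟩ := Submodule.mem_span_singleton.1 (this hy)
  refine ⟨a, ?_⟩
  change ExteriorAlgebra.map I.subtype y = _
  rw [← ha, map_smul, ExteriorAlgebra.map_apply_ιMulti]
  rfl

theorem exists_vec_eq (I : OrientedSubspace V) {n : ℕ} (b : Basis (Fin n) F I.carrier) :
    ∃ a : F, a ≠ 0 ∧ I.vec = a • ExteriorAlgebra.ιMulti F n fun i => (b i : V) := by
  have hn : finrank F I.carrier = n := by rw [finrank_eq_card_basis b, Fintype.card_fin]
  have hv := I.vec_mem
  rw [hn] at hv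
  obtain ⟨a, ha⟩ := exists_smul_ιMulti b hv
  refine ⟨a, ?_, ha⟩
  rintro rfl
  exact I.vec_ne_zero (by rw [ha, zero_smul])

theorem exists_smul_vec (I : OrientedSubspace V) {x : ExteriorAlgebra F V}
    (hx : x ∈ (I.carrier.map (ExteriorAlgebra.ι F)) ^ finrank F I.carrier) :
    ∃ a : F, x = a • I.vec := by
  obtain ⟨a, ha, hIa⟩ := I.exists_vec_eq (finBasis F I.carrier)
  obtain ⟨c, hc⟩ := exists_smul_ιMulti (finBasis F I.carrier) hx
  refine ⟨c * a⁻¹, ?_⟩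
  rw [hIa, smul_smul, mul_assoc, inv_mul_cancel₀ ha, mul_one, hc]

/-- The top power of `J` is a line. The scalar `c` plays the role of the determinant of `T : I → J`
measured by the two orientations. -/
theorem exists_map_vec_eq {I J : OrientedSubspace V} {T : V →ₗ[F] V}
    (hT : I.carrier.map T = J.carrier) (hd : finrank F I.carrier = finrank F J.carrier) :
    ∃ c : F, ExteriorAlgebra.map T I.vec = c • J.vec := by
  apply J.exists_smul_vec
  rw [← hd, ← hT, ← Submodule.map_comp, ← ExteriorAlgebra.map_comp_ι, Submodule.map_comp,
    ← Submodule.map_pow]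
  exact Submodule.mem_map_of_mem I.vec_mem

end OrientedSubspace

namespace OrientedLagrangian

/-- A basis of a Lagrangian subspace. -/
noncomputable def basis (L : OrientedLagrangian V) :
    Basis (Fin (finrank F V / 2)) F L.1.carrier :=
  finBasisOfFinrankEq F L.1.carrier L.finrank_eq

theorem exists_orientation_eq (L : OrientedLagrangian V)
    (b : Basis (Fin (finrank F V / 2)) F L.1.carrier) :
    ∃ a : F, a ≠ 0 ∧ L.1.vec = a • ExteriorAlgebra.ιMulti F _ (fun i => (b i : V)) ∧
      L.orientation = a • exteriorPower.ιMulti F _ fun i => (b i : V) := by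
  obtain ⟨a, ha, h⟩ := L.1.exists_vec_eq b
  exact ⟨a, ha, h, Subtype.ext h⟩

theorem form_eq_zero (L : OrientedLagrangian V) {x y : V} (hx : x ∈ L.1.carrier)
    (hy : y ∈ L.1.carrier) : V.form x y = 0 := by
  have : y ∈ V.form.orthogonal L.1.carrier := by
    rw [show V.form.orthogonal L.1.carrier = L.1.carrier from L.2]; exact hy
  exact this x hx

theorem mem_of_forall (L : OrientedLagrangian V) {y : V}
    (h : ∀ x ∈ L.1.carrier, V.form x y = 0) : y ∈ L.1.carrier := by
  rw [← show V.form.orthogonal L.1.carrier = L.1.carrier from L.2]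
  exact h

theorem two_mul_finrank (L : OrientedLagrangian V) :
    2 * finrank F L.1.carrier = finrank F V := by
  have h := LinearMap.BilinForm.finrank_orthogonal V.nondegenerate L.1.carrier
  rw [show V.form.orthogonal L.1.carrier = L.1.carrier from L.2] at h
  have := Submodule.finrank_le L.1.carrier
  omega

theorem isCompl {L M : OrientedLagrangian V} (h : L.1.carrier ⊓ M.1.carrier = ⊥) :
    IsCompl L.1.carrier M.1.carrier := by
  refine ⟨disjoint_iff.2 h, codisjoint_iff.2 (Submodule.eq_top_of_finrank_eq ?_)⟩
  have h1 := Submodule.finrank_sup_add_finrank_inf_eq L.1.carrier M.1.carrier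
  rw [h, finrank_bot] at h1
  have := L.two_mul_finrank
  have := M.two_mul_finrank
  omega

end OrientedLagrangian

theorem SympSpace.form_neg (V : SympSpace.{w, u} F) (x y : V) : V.form x y = -V.form y x :=
  (LinearMap.IsAlt.neg V.isAlt y x).symm

/-- The matrix `ω(xᵢ, yⱼ)`. -/
def formMatrix (V : SympSpace.{w, u} F) {n : ℕ} (x y : Fin n → V) : Matrix (Fin n) (Fin n) F :=
  Matrix.of fun i j => V.form (x i) (y j)

theorem wedgePairing_ιMulti {n : ℕ} (x y : Fin n → V) (a b : F) :
    wedgePairing V n (a • exteriorPower.ιMulti F n x) (b • exteriorPower.ιMulti F n y) =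
      (-1) ^ n.choose 2 * (a * b * (formMatrix V x y).det) := by
  unfold wedgePairing
  rw [map_smul, map_smul, map_smul, LinearMap.smul_apply, exteriorPower.map_apply_ιMulti,
    exteriorPower.pairingDual_ιMulti_ιMulti, ← Matrix.det_transpose]
  have : (Matrix.of fun i j => ((V.form ∘ x) j) (y i)).transpose = formMatrix V x y := by
    ext; rfl
  rw [this]
  simp only [smul_eq_mul]
  ring

theorem formMatrix_det_swap {n : ℕ} (x y : Fin n → V) :
    (formMatrix V y x).det = (-1) ^ n * (formMatrix V x y).det := by
  have : formMatrix V y x = -(formMatrix V x y).transpose := by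
    ext i j; exact V.form_neg _ _
  rw [this, Matrix.det_neg, Matrix.det_transpose, Fintype.card_fin]

/-- A vector in the kernel of the matrix gives an element of `M` orthogonal to `L`, hence an element
of `L ∩ M = 0`. -/
theorem formMatrix_det_ne_zero {L M : OrientedLagrangian V}
    (h : L.1.carrier ⊓ M.1.carrier = ⊥) {n : ℕ} (l : Basis (Fin n) F L.1.carrier)
    (m : Basis (Fin n) F M.1.carrier) :
    (formMatrix V (fun i => (l i : V)) fun i => (m i : V)).det ≠ 0 := by
  intro h0
  obtain ⟨v, hv, hv0⟩ := Matrix.exists_mulVec_eq_zero_iff.2 h0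
  apply hv
  have hx : ((∑ j, v j • m j : M.1.carrier) : V) ∈ L.1.carrier := by
    apply L.mem_of_forall
    intro x hx
    have : x = ∑ i, l.repr ⟨x, hx⟩ i • (l i : V) := (l.coe_sum_repr ⟨x, hx⟩).symm
    rw [this, map_sum, LinearMap.sum_apply]
    refine Finset.sum_eq_zero fun i _ => ?_
    have h1 := congrFun hv0 i
    simp only [Matrix.mulVec, dotProduct, formMatrix, Matrix.of_apply, Pi.zero_apply] at h1
    rw [map_smul, LinearMap.smul_apply]
    simp only [Submodule.coe_sum, Submodule.coe_smul, map_sum, map_smul, smul_eq_mul]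
    simp only [mul_comm (v _), h1, mul_zero]
  have h2 : ((∑ j, v j • m j : M.1.carrier) : V) = 0 := by
    have : ((∑ j, v j • m j : M.1.carrier) : V) ∈ L.1.carrier ⊓ M.1.carrier := ⟨hx, (∑ j, v j • m j : M.1.carrier).2⟩
    rwa [h, Submodule.mem_bot] at this
  funext j
  exact Fintype.linearIndependent_iff.1 m.linearIndependent v (Subtype.ext h2) j

end TopPower

/-! ## Symmetric transfers between Lagrangians -/

section Transfer

variable {F : Type w} [Field F] {V : SympSpace.{w, u} F}

/-- `T` maps `K` onto `L`, fixes `K ∩ L`, and `(x, y) ↦ ω(x, T y)` is symmetric on `K`. -/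
structure Transfers (K L : Submodule F V) (T : V →ₗ[F] V) : Prop where
  map_eq : K.map T = L
  fix : ∀ x ∈ K, x ∈ L → T x = x
  symm : ∀ x ∈ K, ∀ y ∈ K, V.form x (T y) = V.form y (T x)

theorem Transfers.refl (K : OrientedLagrangian V) :
    Transfers K.1.carrier K.1.carrier LinearMap.id where
  map_eq := Submodule.map_id _
  fix _ _ _ := rfl
  symm x hx y hy := by
    rw [LinearMap.id_apply, LinearMap.id_apply, K.form_eq_zero hx hy, K.form_eq_zero hy hx]

/-- The isomorphism `K → L` induced by a transfer. -/
noncomputable def Transfers.equiv {K L : OrientedLagrangian V} {T : V →ₗ[F] V}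
    (hT : Transfers K.1.carrier L.1.carrier T) : K.1.carrier ≃ₗ[F] L.1.carrier :=
  have hmem : ∀ x ∈ K.1.carrier, T x ∈ L.1.carrier := fun x hx => by
    rw [← hT.map_eq]; exact Submodule.mem_map_of_mem hx
  have hg : Function.Surjective (T.restrict hmem) := by
    rintro ⟨y, hy⟩
    rw [← hT.map_eq] at hy
    obtain ⟨x, hx, rfl⟩ := hy
    exact ⟨⟨x, hx⟩, rfl⟩
  have hd : finrank F K.1.carrier = finrank F L.1.carrier := by rw [K.finrank_eq, L.finrank_eq]
  LinearEquiv.ofInjectiveOfFinrankEq (T.restrict hmem)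
    ((LinearMap.injective_iff_surjective_of_finrank_eq_finrank hd).2 hg) hd

/-- Bases of `K` and `L` matched by a transfer. -/
theorem Transfers.exists_vec_eq {K L : OrientedLagrangian V} {T : V →ₗ[F] V}
    (hT : Transfers K.1.carrier L.1.carrier T) {c : F}
    (hc : ExteriorAlgebra.map T K.1.vec = c • L.1.vec) :
    ∃ b : F, b ≠ 0 ∧
      K.1.vec = (c * b) • ExteriorAlgebra.ιMulti F _ (fun i => (K.basis i : V)) ∧
      L.1.vec = b • ExteriorAlgebra.ιMulti F _ (fun i => T (K.basis i : V)) := by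
  obtain ⟨a, ha, hK, -⟩ := K.exists_orientation_eq K.basis
  obtain ⟨b, hb, hL, -⟩ := L.exists_orientation_eq (K.basis.map hT.equiv)
  have hL' : L.1.vec = b • ExteriorAlgebra.ιMulti F _ (fun i => T (K.basis i : V)) := hL
  refine ⟨b, hb, ?_, hL'⟩
  rw [hK, map_smul, ExteriorAlgebra.map_apply_ιMulti, hL', smul_smul] at hc
  have hne : ExteriorAlgebra.ιMulti F _ (fun i => T (K.basis i : V)) ≠ 0 := by
    intro h
    apply L.1.vec_ne_zero
    rw [hL', h, smul_zero]
  rw [← smul_left_injective F hne hc, hK]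

/-- The projection onto `L` along `N` as a transfer from `K`. -/
theorem exists_transfer {K L N : OrientedLagrangian V} (hK : K.1.carrier ⊓ N.1.carrier = ⊥)
    (hL : L.1.carrier ⊓ N.1.carrier = ⊥) :
    ∃ T : V →ₗ[F] V, Transfers K.1.carrier L.1.carrier T ∧ (∀ x, T x ∈ L.1.carrier) ∧
      (∀ x, x - T x ∈ N.1.carrier) := by
  have hc := OrientedLagrangian.isCompl hL
  have hmem : ∀ x, Submodule.projection _ _ hc x ∈ L.1.carrier := fun x => by
    have h := LinearMap.mem_range_self (Submodule.projection _ _ hc) x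
    rwa [Submodule.range_projection] at h
  have hsub := Submodule.sub_projection_mem hc
  set T := Submodule.projection _ _ hc
  refine ⟨T, ⟨?_, ?_, ?_⟩, hmem, hsub⟩
  · refine Submodule.eq_of_le_of_finrank_eq ?_ ?_
    · rintro _ ⟨x, -, rfl⟩
      exact hmem x
    -- The kernel of the projection on `K` is `K ∩ N = 0`, so equality of dimensions gives
    -- surjectivity onto `L`.
    · rw [L.finrank_eq, ← K.finrank_eq, ← LinearMap.range_domRestrict]
      refine LinearMap.finrank_range_of_inj ?_
      rw [injective_iff_map_eq_zero]
      rintro ⟨x, hx⟩ h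
      have h0 : T x = 0 := h
      have h1 := hsub x
      rw [h0, sub_zero] at h1
      have h2 : x ∈ K.1.carrier ⊓ N.1.carrier := ⟨hx, h1⟩
      rw [hK, Submodule.mem_bot] at h2
      exact Subtype.ext h2
  · intro x _ hx
    have : x - T x ∈ L.1.carrier ⊓ N.1.carrier := ⟨sub_mem hx (hmem x), hsub x⟩
    rw [hL, Submodule.mem_bot, sub_eq_zero] at this
    exact this.symm
  -- Expand `0 = ω(x - T x, y - T y)`, which holds on `N`; the terms `ω(x, y)` and `ω(T x, T y)`
  -- vanish since `K` and `L` are isotropic.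
  · intro x hx y hy
    have h1 := K.form_eq_zero hx hy
    have h2 := N.form_eq_zero (hsub x) (hsub y)
    have h3 := L.form_eq_zero (hmem x) (hmem y)
    have h4 := V.form_neg y (T x)
    simp only [map_sub, LinearMap.sub_apply] at h2
    linear_combination -h2 + h1 - h4 + h3

variable [Fintype F] [DecidableEq F] (ψ : AddChar F ℂ)

/-- The Gauss sum of the quadratic form `x ↦ ω(x, T x)` on `K`. -/
noncomputable def transferSum (K : Submodule F V) (T : V →ₗ[F] V) : ℂ :=
  ∑ᶠ k : K, ψ (2⁻¹ * V.form k.1 (T k.1))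

instance SympSpace.finite (V : SympSpace.{w, u} F) : Finite V := Module.finite_of_finite F

/-- The signed Gauss sum of a transfer does not depend on the transfer. -/
theorem Transfers.sign_mul_sum_eq (hF : ringChar F ≠ 2) (hψ : ψ ≠ 1)
    {K L : OrientedLagrangian V} {T T' : V →ₗ[F] V}
    (hT : Transfers K.1.carrier L.1.carrier T) (hT' : Transfers K.1.carrier L.1.carrier T')
    {c c' : F} (hc : ExteriorAlgebra.map T K.1.vec = c • L.1.vec)
    (hc' : ExteriorAlgebra.map T' K.1.vec = c' • L.1.vec) :
    quadSign F c * transferSum ψ K.1.carrier T =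
      quadSign F c' * transferSum ψ K.1.carrier T' := by
  let _ : Fintype K.1.carrier := Fintype.ofFinite _
  -- `A` is `T⁻¹ T'` on `K`, so the form of `T'` is that of `T` twisted by `A`, and `c' = det A *
  -- c`.
  let A : K.1.carrier →ₗ[F] K.1.carrier := (hT'.equiv.trans hT.equiv.symm).toLinearMap
  have hA : ∀ x : K.1.carrier, T (A x : V) = T' x := by
    intro x
    have : hT.equiv (A x) = hT'.equiv x := hT.equiv.apply_symm_apply _
    exact congrArg Subtype.val this
  have hdet : LinearMap.det A ≠ 0 :=
    (LinearEquiv.isUnit_det' (hT'.equiv.trans hT.equiv.symm)).ne_zero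
  have hcc : c' = LinearMap.det A * c := by
    obtain ⟨a, ha, hv, -⟩ := K.exists_orientation_eq K.basis
    have h1 := AlternatingMap.apply_eq_det_smul K.basis
      ((ExteriorAlgebra.ιMulti F (finrank F V / 2) (M := V)).compLinearMap
        (T ∘ₗ K.1.carrier.subtype)) (A ∘ K.basis)
    rw [Basis.det_comp, Basis.det_self, mul_one] at h1
    have h2 : (ExteriorAlgebra.ιMulti F (finrank F V / 2)) (fun i => T' (K.basis i : V)) =
        LinearMap.det A •
          (ExteriorAlgebra.ιMulti F (finrank F V / 2)) (fun i => T (K.basis i : V)) := by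
      rw [show (fun i => T' (K.basis i : V)) = fun i => T (A (K.basis i) : V) from
        funext fun i => (hA _).symm]
      exact h1
    have h3 : c' • L.1.vec = (LinearMap.det A * c) • L.1.vec := by
      rw [← hc', mul_smul, ← hc, hv, map_smul, map_smul, ExteriorAlgebra.map_apply_ιMulti,
        ExteriorAlgebra.map_apply_ιMulti, smul_comm]
      exact congrArg _ h2
    exact smul_left_injective F L.1.vec_ne_zero h3
  let B : LinearMap.BilinForm F K.1.carrier :=
    (V.form.compl₁₂ K.1.carrier.subtype (T ∘ₗ K.1.carrier.subtype))
  have hB : ∀ x y : K.1.carrier, B x y = V.form x.1 (T y.1) := fun _ _ => rfl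
  have key := sum_addChar_twist ψ hF hψ B
    (fun x y => hT.symm _ x.2 _ y.2) A hdet
    (fun x y => by rw [hB, hB, hA, hA]; exact hT'.symm _ x.2 _ y.2)
    -- A radical vector of `ω(x, T y)` is orthogonal to `T K = L`, hence lies in `K ∩ L`, where both
    -- transfers are the identity.
    (fun x hx => by
      have hxL : x.1 ∈ L.1.carrier := by
        apply L.mem_of_forall
        intro y hy
        rw [← hT.map_eq] at hy
        obtain ⟨z, hz, rfl⟩ := hy
        rw [V.form_neg, neg_eq_zero]
        exact hx ⟨z, hz⟩
      apply hT.equiv.injective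
      apply Subtype.ext
      change T (A x).1 = T x.1
      rw [hA, hT'.fix _ x.2 hxL, hT.fix _ x.2 hxL])
  unfold transferSum
  rw [finsum_eq_sum_of_fintype, finsum_eq_sum_of_fintype]
  have key' : ∑ x : K.1.carrier, ψ (2⁻¹ * V.form x.1 (T' x.1)) =
      quadSign F (LinearMap.det A) * ∑ x : K.1.carrier, ψ (2⁻¹ * V.form x.1 (T x.1)) := by
    rw [← (show _ from key : _ = quadSign F (LinearMap.det A) * ∑ x : K.1.carrier,
      ψ (2⁻¹ * V.form x.1 (T x.1)))]
    exact Finset.sum_congr rfl fun x _ => by rw [hB, hA]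
  rw [key', hcc, map_mul]
  linear_combination (-quadSign F c * ∑ x : K.1.carrier, ψ (2⁻¹ * V.form x.1 (T x.1))) *
    quadSign_mul_self hdet

theorem normConst_eq {M L : OrientedLagrangian V} {l m : Fin (finrank F V / 2) → V} {a b : F}
    (hL : L.1.vec = a • ExteriorAlgebra.ιMulti F _ l)
    (hM : M.1.vec = b • ExteriorAlgebra.ιMulti F _ m) :
    normConst ψ M L = (gaussSumOne ψ / (Fintype.card F : ℂ)) ^ (finrank F V / 2) *
      quadSign F (a * b * (formMatrix V l m).det) := by
  have h1 : L.orientation = a • exteriorPower.ιMulti F _ l := Subtype.ext hL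
  have h2 : M.orientation = b • exteriorPower.ιMulti F _ m := Subtype.ext hM
  -- The sign `(-1)^(n choose 2)` occurs once in `normConst` and once in `wedgePairing`, and
  -- cancels.
  rw [normConst, h1, h2, wedgePairing_ιMulti, ← mul_assoc, ← pow_add, ← two_mul, pow_mul,
    neg_one_sq, one_pow, one_mul, quadSign_apply]

/-- The normalizing constant of a transversal pair as a Gauss sum. -/
theorem Transfers.normConst_eq (hF : ringChar F ≠ 2) (hψ : ψ ≠ 1)
    {K L : OrientedLagrangian V} (h : K.1.carrier ⊓ L.1.carrier = ⊥) {T : V →ₗ[F] V}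
    (hT : Transfers K.1.carrier L.1.carrier T)
    {c : F} (hc : ExteriorAlgebra.map T K.1.vec = c • L.1.vec) :
    normConst ψ L K = ((Fintype.card F : ℂ) ^ (finrank F V / 2))⁻¹ *
      (quadSign F c * transferSum ψ K.1.carrier T) := by
  let _ : Fintype K.1.carrier := Fintype.ofFinite _
  obtain ⟨b, hb, hK, hL⟩ := hT.exists_vec_eq hc
  have hdet := formMatrix_det_ne_zero h K.basis (K.basis.map hT.equiv)
  change (formMatrix V (fun i => (K.basis i : V)) fun i => T (K.basis i : V)).det ≠ 0 at hdet
  -- In the bases matched by `T`, the matrix computing `ω_∧` is also the Gram matrix of `x ↦ ω(x, T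
  -- x)` on `K`. Both sides then contain `σ(det M)` and the same power of the Gauss sum.
  set M := formMatrix V (fun i => (K.basis i : V)) fun i => T (K.basis i : V) with hM
  have hsymm : M.IsSymm := by
    ext i j
    exact hT.symm _ (K.basis j).2 _ (K.basis i).2
  rw [_root_.normConst_eq ψ hK hL, ← hM]
  have hsum : transferSum ψ K.1.carrier T = quadSign F M.det * gaussSumOne ψ ^ (finrank F V / 2) := by
    have := sum_addChar_quadratic ψ hF hψ M hsymm hdet
    rw [Fintype.card_fin] at this
    rw [← this, transferSum, finsum_eq_sum_of_fintype]
    refine Fintype.sum_equiv K.basis.equivFun.toEquiv _ _ fun x => ?_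
    have hx : (x : V) = ∑ i, K.basis.equivFun x i • (K.basis i : V) :=
      (K.basis.coe_sum_repr x).symm
    congr 2
    conv_lhs => rw [hx]
    simp only [map_sum, LinearMap.sum_apply, map_smul, LinearMap.smul_apply, dotProduct,
      Matrix.mulVec, M, formMatrix, Matrix.of_apply, smul_eq_mul]
    refine Finset.sum_congr rfl fun i _ => ?_
    change _ = K.basis.equivFun x i * _
    rw [Finset.mul_sum, Finset.mul_sum]
    refine Finset.sum_congr rfl fun j _ => ?_
    change _ = K.basis.equivFun x i * (_ * K.basis.equivFun x j)
    rw [hT.symm _ (K.basis i).2 _ (K.basis j).2]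
    ring
  rw [hsum, map_mul, map_mul, map_mul, div_pow]
  linear_combination (gaussSumOne ψ ^ (finrank F V / 2) / Fintype.card F ^ (finrank F V / 2) *
    quadSign F c * quadSign F M.det) * quadSign_mul_self hb

/-- The orientation of `N` enters twice and drops out. Since `x - T x` lies in `N`, the two pairing
matrices agree up to the swap of arguments, which costs `(-1)^n`; the identity `G₁² = σ(-1) q`
absorbs this sign and turns `(G₁ / q)^(2n)` into `q^(-n)`. -/
theorem normConst_mul_normConst (hF : ringChar F ≠ 2) (hψ : ψ ≠ 1) {K L N : OrientedLagrangian V}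
    (hL : L.1.carrier ⊓ N.1.carrier = ⊥) {T : V →ₗ[F] V}
    (hT : Transfers K.1.carrier L.1.carrier T) (hTN : ∀ x, x - T x ∈ N.1.carrier)
    {c : F} (hc : ExteriorAlgebra.map T K.1.vec = c • L.1.vec) :
    normConst ψ L N * normConst ψ N K =
      ((Fintype.card F : ℂ) ^ (finrank F V / 2))⁻¹ * quadSign F c := by
  obtain ⟨b, hb, hKv, hLv⟩ := hT.exists_vec_eq hc
  obtain ⟨d, hd, hNv, -⟩ := N.exists_orientation_eq N.basis
  have hdet := formMatrix_det_ne_zero hL (K.basis.map hT.equiv) N.basis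
  change (formMatrix V (fun i => T (K.basis i : V)) fun i => (N.basis i : V)).det ≠ 0 at hdet
  have hdet' : formMatrix V (fun i => (K.basis i : V)) (fun i => (N.basis i : V)) =
      formMatrix V (fun i => T (K.basis i : V)) fun i => (N.basis i : V) := by
    ext i j
    have := N.form_eq_zero (hTN (K.basis i : V)) (N.basis j).2
    rw [map_sub, LinearMap.sub_apply, sub_eq_zero] at this
    exact this
  rw [normConst_eq ψ hNv hLv, normConst_eq ψ hKv hNv, hdet', formMatrix_det_swap]
  set D := (formMatrix V (fun i => T (K.basis i : V)) fun i => (N.basis i : V)).det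
  have hG := gaussSumOne_sq ψ hF hψ
  have hq : (Fintype.card F : ℂ) ≠ 0 := Nat.cast_ne_zero.2 Fintype.card_ne_zero
  have h1 := quadSign_mul_self (F := F) (a := -1) (neg_ne_zero.2 one_ne_zero)
  have hG' : (gaussSumOne ψ / (Fintype.card F : ℂ)) * (gaussSumOne ψ / (Fintype.card F : ℂ)) *
      quadSign F (-1) = (Fintype.card F : ℂ)⁻¹ := by
    field_simp
    linear_combination quadSign F (-1) * hG + Fintype.card F * h1
  have hG'' := congrArg (· ^ (finrank F V / 2)) hG'
  simp only [mul_pow, inv_pow] at hG''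
  rw [← hG'', map_mul, map_mul, map_mul, map_mul, map_mul, map_mul, map_pow]
  have e1 := quadSign_mul_self hb
  have e2 := quadSign_mul_self hd
  have e3 := quadSign_mul_self hdet
  have : quadSign F b * quadSign F b * (quadSign F d * quadSign F d) *
    (quadSign F D * quadSign F D) = 1 := by rw [e1, e2, e3]; ring
  linear_combination ((gaussSumOne ψ / (Fintype.card F : ℂ)) ^ (finrank F V / 2) *
    (gaussSumOne ψ / (Fintype.card F : ℂ)) ^ (finrank F V / 2) *
      quadSign F (-1) ^ (finrank F V / 2) * quadSign F c) * this

end Transfer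

/-! ## Common transversals -/

section Transversal

variable {F : Type w} [Field F]

/-- A proper subspace has at most a fraction `1 / q` of the vectors, and all of them share `0`, so
`q` of them cannot cover the whole space. -/
theorem exists_forall_notMem_submodule [Fintype F] {W : Type*} [AddCommGroup W] [Module F W]
    [FiniteDimensional F W] {ι : Type*} [Fintype ι] (hι : Fintype.card ι ≤ Fintype.card F)
    (S : ι → Submodule F W) (hS : ∀ i, S i ≠ ⊤) : ∃ v, ∀ i, v ∉ S i := by
  classical
  have : Finite W := Module.finite_of_finite F
  let _ : Fintype W := Fintype.ofFinite W
  by_contra! h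
  rcases isEmpty_or_nonempty ι with hE | hE
  · obtain ⟨i, -⟩ := h 0; exact hE.elim i
  set q := Fintype.card F
  set N := Fintype.card W
  have hq : 2 ≤ q := Fintype.one_lt_card
  have hc : ∀ i, q * Fintype.card (S i) ≤ N := fun i => by
    have hlt := Submodule.finrank_lt (hS i)
    rw [Module.card_eq_pow_finrank (K := F) (V := S i), ← pow_succ',
      show N = _ from Module.card_eq_pow_finrank (K := F) (V := W)]
    exact Nat.pow_le_pow_right (by omega) hlt
  have hc1 : ∀ i, 1 ≤ Fintype.card (S i) := fun i => Fintype.card_pos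
  -- Removing the common vector `0` is what makes the count strict when there are exactly `q`
  -- subspaces.
  let E : ι → Finset W := fun i => (Finset.univ.filter (· ∈ S i)).erase 0
  have hE' : ∀ i, (E i).card + 1 = Fintype.card (S i) := fun i => by
    rw [Finset.card_erase_add_one (by simp), Fintype.card_subtype]
  have hsub : (Finset.univ : Finset W).erase 0 ⊆ Finset.univ.biUnion E := by
    intro v hv
    obtain ⟨i, hi⟩ := h v
    simp only [Finset.mem_biUnion, Finset.mem_univ, true_and, E, Finset.mem_erase,
      Finset.mem_filter]
    exact ⟨i, (Finset.mem_erase.1 hv).1, hi⟩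
  have h1 := (Finset.card_le_card hsub).trans Finset.card_biUnion_le
  rw [Finset.card_erase_of_mem (Finset.mem_univ _), Finset.card_univ] at h1
  have h2 : ∑ i, q * ((E i).card + 1) ≤ ∑ _i : ι, N :=
    Finset.sum_le_sum fun i _ => by rw [hE']; exact hc i
  rw [← Finset.mul_sum, Finset.sum_add_distrib, Finset.sum_const, Finset.sum_const,
    Finset.card_univ, smul_eq_mul, smul_eq_mul, mul_one] at h2
  obtain ⟨i⟩ := hE
  have h3 : q ≤ N := le_trans (Nat.le_mul_of_pos_right q (hc1 i)) (hc i)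
  change N - 1 ≤ _ at h1
  set s := ∑ i, (E i).card
  set m := Fintype.card ι
  have h4 : q * (N - 1 + m) ≤ m * N := le_trans (Nat.mul_le_mul_left q (by omega)) h2
  obtain ⟨r, hr⟩ : ∃ r, N = r + 1 := ⟨N - 1, by omega⟩
  rw [hr, Nat.add_sub_cancel] at h4
  -- The inequality `q (r + m) ≤ m (r + 1)` with `m ≤ q` forces `m = 1`, and then `q ≤ 1`.
  have hm : 1 ≤ m := Fintype.card_pos_iff.2 ⟨i⟩
  have h5 : r + m ≤ r + 1 :=
    Nat.le_of_mul_le_mul_left ((Nat.mul_le_mul_right (r + m) hι).trans h4) hm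
  have hm1 : m = 1 := by omega
  rw [hm1] at h4
  have h6 : q ≤ 1 := Nat.le_of_mul_le_mul_right h4 (Nat.succ_pos r)
  omega

variable {V : SympSpace.{w, u} F}

theorem OrientedSubspace.exists_carrier_eq (I : Submodule F V) :
    ∃ J : OrientedSubspace V, J.carrier = I := by
  refine ⟨⟨I, ExteriorAlgebra.ιMulti F _ fun i => (finBasis F I i : V), ?_, ?_⟩, rfl⟩
  · rw [top_eq_map]
    refine ⟨ExteriorAlgebra.ιMulti F _ (finBasis F I), ExteriorAlgebra.ιMulti_range F _ ⟨_, rfl⟩, ?_⟩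
    exact ExteriorAlgebra.map_apply_ιMulti _ _
  · exact ExteriorAlgebra.ιMulti_ne_zero
      ((finBasis F I).linearIndependent.map' I.subtype (Submodule.ker_subtype I))

/-- Take `W` maximal among the isotropic subspaces meeting every `P i` trivially. If `W` were not
Lagrangian, a vector of `W^⊥` outside every `W + P i` would enlarge it. -/
theorem exists_lagrangian_disjoint [Fintype F] {ι : Type*} [Fintype ι] [Nonempty ι]
    (hι : Fintype.card ι ≤ Fintype.card F) (P : ι → Submodule F V)
    (hP : ∀ i, P i ≤ V.form.orthogonal (P i)) :
    ∃ N : OrientedLagrangian V, ∀ i, P i ⊓ N.1.carrier = ⊥ := by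
  let s : Set (Submodule F V) := {W | W ≤ V.form.orthogonal W ∧ ∀ i, P i ⊓ W = ⊥}
  obtain ⟨W, hWs, hmax⟩ := wellFounded_gt.has_min s ⟨⊥, bot_le, fun i => inf_bot_eq _⟩
  suffices hW : V.form.orthogonal W ≤ W by
    obtain ⟨J, rfl⟩ := OrientedSubspace.exists_carrier_eq W
    exact ⟨⟨J, le_antisymm hW hWs.1⟩, hWs.2⟩
  by_contra hW
  have hS : ∀ i, (W ⊔ P i).comap (V.form.orthogonal W).subtype ≠ ⊤ := by
    intro i h
    apply hW
    have hle : V.form.orthogonal W ≤ W ⊔ P i := by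
      rwa [Submodule.comap_subtype_eq_top] at h
    -- If `W^⊥` were contained in `W + P i`, it would be isotropic because `P i` is, and so
    -- contained in `W^⊥⊥ = W`.
    have : V.form.orthogonal W ≤ V.form.orthogonal (V.form.orthogonal W) := by
      intro y hy x hx
      obtain ⟨a, ha, p, hp, rfl⟩ := Submodule.mem_sup.1 (hle hx)
      obtain ⟨b, hb, p', hp', rfl⟩ := Submodule.mem_sup.1 (hle hy)
      have h1 : V.form a (b + p') = 0 := hy a ha
      have h2 : V.form p p' = 0 := hP i hp' p hp
      have h3 : V.form (a + p) b = 0 := V.isAlt.isRefl _ _ (hx b hb)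
      have h4 : V.form a b = 0 := hWs.1 hb a ha
      simp only [map_add, LinearMap.add_apply] at h1 h3 ⊢
      change _ = _
      linear_combination h1 + h2 + h3 - h4
    rwa [LinearMap.BilinForm.orthogonal_orthogonal V.nondegenerate V.isAlt.isRefl] at this
  obtain ⟨⟨v, hv⟩, hvS⟩ := exists_forall_notMem_submodule hι _ hS
  have hvP : ∀ i, v ∉ W ⊔ P i := hvS
  refine hmax (W ⊔ Submodule.span F {v}) ⟨?_, fun i => ?_⟩ ?_
  · intro y hy x hx
    obtain ⟨a, ha, p, hp, rfl⟩ := Submodule.mem_sup.1 hx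
    obtain ⟨b, hb, p', hp', rfl⟩ := Submodule.mem_sup.1 hy
    obtain ⟨c, rfl⟩ := Submodule.mem_span_singleton.1 hp
    obtain ⟨c', rfl⟩ := Submodule.mem_span_singleton.1 hp'
    have h1 : V.form a b = 0 := hWs.1 hb a ha
    have h2 : V.form a v = 0 := hv a ha
    have h3 : V.form v b = 0 := V.isAlt.isRefl _ _ (hv b hb)
    change V.form _ _ = 0
    simp [h1, h2, h3, V.isAlt.self_eq_zero]
  · rw [Submodule.eq_bot_iff]
    rintro x ⟨hxP, hx⟩
    obtain ⟨a, ha, p, hp, rfl⟩ := Submodule.mem_sup.1 hx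
    obtain ⟨c, rfl⟩ := Submodule.mem_span_singleton.1 hp
    by_cases hc : c = 0
    · subst hc
      have : a + (0 : F) • v ∈ P i ⊓ W := ⟨hxP, by simpa using ha⟩
      rw [hWs.2 i] at this
      exact this
    · exfalso
      apply hvP i
      have hv' : v = -(c⁻¹ • a) + c⁻¹ • (a + c • v) := by
        rw [smul_add, smul_smul, inv_mul_cancel₀ hc, one_smul]; abel
      rw [hv']
      exact add_mem (Submodule.mem_sup_left (neg_mem (W.smul_mem _ ha)))
        (Submodule.mem_sup_right ((P i).smul_mem _ hxP))
  · refine lt_of_le_of_ne le_sup_left fun h => ?_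
    apply hvP (Classical.arbitrary ι)
    apply Submodule.mem_sup_left
    rw [h]
    exact Submodule.mem_sup_right (Submodule.mem_span_singleton_self v)

theorem OrientedLagrangian.nonempty [Fintype F] (V : SympSpace.{w, u} F) :
    Nonempty (OrientedLagrangian V) := by
  obtain ⟨N, -⟩ := exists_lagrangian_disjoint (V := V) (ι := Unit)
    (by simpa using Nat.succ_le_of_lt Fintype.card_pos) (fun _ => ⊥) fun _ => bot_le
  exact ⟨N⟩

/-- Odd `q` means `q ≥ 3`, just enough to avoid three Lagrangians at once. Multiplicativity needs
all three. -/
theorem OrientedLagrangian.exists_transversal [Fintype F] (hF : ringChar F ≠ 2)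
    (K L M : OrientedLagrangian V) :
    ∃ N : OrientedLagrangian V, K.1.carrier ⊓ N.1.carrier = ⊥ ∧ L.1.carrier ⊓ N.1.carrier = ⊥ ∧
      M.1.carrier ⊓ N.1.carrier = ⊥ := by
  have hle : ∀ L : OrientedLagrangian V, L.1.carrier ≤ V.form.orthogonal L.1.carrier :=
    fun L => (show V.form.orthogonal L.1.carrier = L.1.carrier from L.2).ge
  have hq : 3 ≤ Fintype.card F := by
    have h1 : 1 < Fintype.card F := Fintype.one_lt_card
    have h2 := FiniteField.odd_card_of_char_ne_two hF
    omega
  obtain ⟨N, hN⟩ := exists_lagrangian_disjoint (V := V) (ι := Fin 3) (by simpa using hq)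
    ![K.1.carrier, L.1.carrier, M.1.carrier] (by
      intro i
      fin_cases i
      exacts [hle K, hle L, hle M])
  exact ⟨N, hN 0, hN 1, hN 2⟩

theorem OrientedLagrangian.orthogonal_inf (K L : OrientedLagrangian V) :
    V.form.orthogonal (K.1.carrier ⊓ L.1.carrier) = K.1.carrier ⊔ L.1.carrier := by
  have : V.form.orthogonal (K.1.carrier ⊔ L.1.carrier) = K.1.carrier ⊓ L.1.carrier := by
    apply le_antisymm
    · exact fun x hx => ⟨K.mem_of_forall fun y hy => hx y (Submodule.mem_sup_left hy),
        L.mem_of_forall fun y hy => hx y (Submodule.mem_sup_right hy)⟩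
    · rintro x ⟨hxK, hxL⟩ y hy
      obtain ⟨a, ha, b, hb, rfl⟩ := Submodule.mem_sup.1 hy
      change V.form _ _ = 0
      rw [map_add, LinearMap.add_apply, K.form_eq_zero ha hxK, L.form_eq_zero hb hxL, add_zero]
  rw [← this, LinearMap.BilinForm.orthogonal_orthogonal V.nondegenerate V.isAlt.isRefl]

theorem exists_transfer_map_vec [Fintype F] (hF : ringChar F ≠ 2) (K L : OrientedLagrangian V) :
    ∃ (T : V →ₗ[F] V) (c : F), Transfers K.1.carrier L.1.carrier T ∧
      ExteriorAlgebra.map T K.1.vec = c • L.1.vec := by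
  obtain ⟨N, hK, hL, -⟩ := OrientedLagrangian.exists_transversal hF K L L
  obtain ⟨T, hT, -⟩ := exists_transfer hK hL
  obtain ⟨c, hc⟩ := OrientedSubspace.exists_map_vec_eq hT.map_eq
    (by rw [K.finrank_eq, L.finrank_eq])
  exact ⟨T, c, hT, hc⟩

end Transversal

/-! ## Intertwining maps between the models -/

section Intertwiners

variable {F : Type w} [Field F] (ψ : AddChar F ℂ) {V : SympSpace.{w, u} F}

open Classical in
/-- The function supported on `K × F` given there by `(k, z) ↦ ψ z`. -/
noncomputable def lagDelta (K : OrientedLagrangian V) : lagModel ψ K :=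
  ⟨fun h => if h.vec ∈ K.1.carrier then ψ h.z else 0, by
    constructor
    · intro z h
      simp only [Heisenberg.mul_vec, Heisenberg.ofCenter, zero_add, Heisenberg.mul_z, map_zero,
        LinearMap.zero_apply, mul_zero, add_zero, AddChar.map_add_eq_mul]
      split_ifs <;> simp
    · intro l hl h
      simp only [Heisenberg.mul_vec, Heisenberg.ofVec, Heisenberg.mul_z, zero_add]
      by_cases hh : h.vec ∈ K.1.carrier
      · rw [if_pos (add_mem hl hh), if_pos hh, K.form_eq_zero hl hh, mul_zero, add_zero]
      · rw [if_neg fun h' => hh ((Submodule.add_mem_iff_right _ hl).1 h'), if_neg hh]⟩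

theorem lagDelta_of_mem {K : OrientedLagrangian V} {h : Heisenberg V}
    (hh : h.vec ∈ K.1.carrier) : (lagDelta ψ K).1 h = ψ h.z := if_pos hh

theorem lagDelta_of_notMem {K : OrientedLagrangian V} {h : Heisenberg V}
    (hh : h.vec ∉ K.1.carrier) : (lagDelta ψ K).1 h = 0 := if_neg hh

theorem lagDelta_one (K : OrientedLagrangian V) : (lagDelta ψ K).1 1 = 1 := by
  rw [lagDelta_of_mem ψ (by simp), Heisenberg.one_z, AddChar.map_zero_eq_one]

theorem lagModelRep_apply (L : OrientedLagrangian V) (k : Heisenberg V) (f : lagModel ψ L)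
    (h : Heisenberg V) : (lagModelRep ψ L k f).1 h = f.1 (h * k) := rfl

theorem lagModelRep_lagDelta {K : OrientedLagrangian V} {k : V} (hk : k ∈ K.1.carrier) :
    lagModelRep ψ K (Heisenberg.ofVec k) (lagDelta ψ K) = lagDelta ψ K := by
  ext h
  rw [lagModelRep_apply]
  by_cases hh : h.vec ∈ K.1.carrier
  · rw [lagDelta_of_mem ψ hh, lagDelta_of_mem ψ (add_mem hh hk)]
    simp [Heisenberg.ofVec, K.form_eq_zero hh hk]
  · rw [lagDelta_of_notMem ψ hh, lagDelta_of_notMem ψ]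
    exact fun h' => hh ((Submodule.add_mem_iff_left _ hk).1 h')

/-- The translates of `lagDelta` span the model. -/
theorem sum_smul_lagDelta [Fintype F] {K : OrientedLagrangian V}
    [Fintype V] (f : lagModel ψ K) :
    (Nat.card K.1.carrier : ℂ) • f =
      ∑ v : V, f.1 (Heisenberg.ofVec v) • lagModelRep ψ K (Heisenberg.ofVec v)⁻¹ (lagDelta ψ K) := by
  classical
  have : Finite K.1.carrier := Subtype.finite
  let _ : Fintype K.1.carrier := Fintype.ofFinite _
  ext h
  simp only [Submodule.coe_smul, AddSubmonoidClass.coe_finsetSum, Finset.sum_apply,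
    Pi.smul_apply, smul_eq_mul, lagModelRep_apply]
  -- After the substitution `v = h.vec - x`, the summand is `f h` for `x` in `K` and zero otherwise,
  -- whence the factor `|K|`.
  rw [← Equiv.sum_comp (Equiv.subLeft h.vec)]
  simp only [Equiv.subLeft_apply]
  have hterm : ∀ x : V, f.1 (Heisenberg.ofVec (h.vec - x)) *
      (lagDelta ψ K).1 (h * (Heisenberg.ofVec (h.vec - x))⁻¹) =
      if x ∈ K.1.carrier then f.1 h else 0 := by
    intro x
    have hvec : (h * (Heisenberg.ofVec (h.vec - x))⁻¹).vec = x := by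
      simp [Heisenberg.ofVec]
    split_ifs with hx
    · rw [lagDelta_of_mem ψ (by rw [hvec]; exact hx)]
      have h1 := f.2.2 x hx (Heisenberg.ofVec (h.vec - x))
      have h3 : h = Heisenberg.ofCenter (h * (Heisenberg.ofVec (h.vec - x))⁻¹).z *
          (Heisenberg.ofVec x * Heisenberg.ofVec (h.vec - x)) := by
        ext
        · simp [Heisenberg.ofCenter, Heisenberg.ofVec]
        · simp [Heisenberg.ofCenter, Heisenberg.ofVec, V.isAlt.self_eq_zero, V.form_neg x]
      conv_rhs => rw [h3, f.2.1, h1]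
      ring
    · rw [lagDelta_of_notMem ψ (by rw [hvec]; exact hx), mul_zero]
  rw [Finset.sum_congr rfl fun x _ => hterm x, ← Finset.sum_filter, Finset.sum_const,
    nsmul_eq_mul, Nat.card_eq_fintype_card, Fintype.card_subtype]

/-- A function in a model that is right invariant under a line of `L` not orthogonal to `h`
vanishes at `h`. -/
theorem lagModel_apply_eq_zero (hψ : ψ ≠ 1) (h2 : (2 : F) ≠ 0) {L : OrientedLagrangian V}
    (f : lagModel ψ L) {h : Heisenberg V} {i : V} (hi : V.form i h.vec ≠ 0)
    (hL : ∀ c : F, c • i ∈ L.1.carrier)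
    (hf : ∀ c : F, f.1 (h * Heisenberg.ofVec (c • i)) = f.1 h) : f.1 h = 0 := by
  obtain ⟨a, ha⟩ : ∃ a, ψ a ≠ 1 := by
    by_contra! hcon
    exact hψ (DFunLike.ext _ _ hcon)
  -- The multiple `j` of `i` is scaled so that `ω(h, j) = a` with `ψ a ≠ 1`. Moving `j` from the
  -- right of `h` to the left then multiplies the value by `ψ a`, although both translations leave
  -- it unchanged.
  have h5 := hf (-(a / V.form i h.vec))
  have hjL := hL (-(a / V.form i h.vec))
  set j : V := (-(a / V.form i h.vec)) • i with hj
  have hform : V.form h.vec j = a := by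
    rw [V.form_neg, hj, map_smul, LinearMap.smul_apply, smul_eq_mul, neg_mul, neg_neg,
      div_mul_cancel₀ _ hi]
  have hcomm : h * Heisenberg.ofVec j =
      Heisenberg.ofCenter a * (Heisenberg.ofVec j * h) := by
    ext
    · simp [Heisenberg.ofCenter, Heisenberg.ofVec, add_comm]
    · simp only [Heisenberg.ofCenter, Heisenberg.ofVec, Heisenberg.mul_z, hform, map_zero,
        LinearMap.zero_apply, V.form_neg j]
      field_simp
      ring
  rw [hcomm, f.2.1, f.2.2 j hjL] at h5
  have h6 : (ψ a - 1) * f.1 h = 0 := by linear_combination h5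
  exact (mul_eq_zero.1 h6).resolve_left (sub_ne_zero.2 ha)

/-- An intertwining map is determined by the value of the image of `lagDelta` at `1`. -/
theorem intertwiner_ext [Fintype F] (hψ : ψ ≠ 1) (h2 : (2 : F) ≠ 0) {K L : OrientedLagrangian V}
    {A B : lagModel ψ K →ₗ[ℂ] lagModel ψ L}
    (hA : ∀ h f, A (lagModelRep ψ K h f) = lagModelRep ψ L h (A f))
    (hB : ∀ h f, B (lagModelRep ψ K h f) = lagModelRep ψ L h (B f))
    (hAB : (A (lagDelta ψ K)).1 1 = (B (lagDelta ψ K)).1 1) : A = B := by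
  let _ : Fintype V := Fintype.ofFinite V
  have : Finite K.1.carrier := Subtype.finite
  rw [← sub_eq_zero]
  set D := A - B with hD
  have hDi : ∀ h f, D (lagModelRep ψ K h f) = lagModelRep ψ L h (D f) := by
    intro h f
    rw [hD, LinearMap.sub_apply, LinearMap.sub_apply, hA, hB, map_sub]
  have hD1 : (D (lagDelta ψ K)).1 1 = 0 := by
    change (A (lagDelta ψ K)).1 1 - (B (lagDelta ψ K)).1 1 = 0
    rw [hAB, sub_self]
  have hright : ∀ k ∈ K.1.carrier, ∀ h, (D (lagDelta ψ K)).1 (h * Heisenberg.ofVec k) =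
      (D (lagDelta ψ K)).1 h := by
    intro k hk h
    rw [← lagModelRep_apply, ← hDi, lagModelRep_lagDelta ψ hk]
  have hzero : D (lagDelta ψ K) = 0 := by
    ext h
    change (D (lagDelta ψ K)).1 h = 0
    -- The image of the delta function is invariant under `L` on the left and `K` on the right. On
    -- `(K + L) × F` it is thus determined by its value at `1`. Elsewhere, as `K + L = (K ∩ L)^⊥`,
    -- some `i` in `K ∩ L` is not orthogonal to `h`, and the value vanishes.
    by_cases hv : h.vec ∈ K.1.carrier ⊔ L.1.carrier
    · obtain ⟨k, hk, l, hl, hkl⟩ := Submodule.mem_sup.1 hv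
      have h3 : h = Heisenberg.ofCenter (h.z - 2⁻¹ * V.form l k) *
          (Heisenberg.ofVec l * Heisenberg.ofVec k) := by
        ext
        · simp [Heisenberg.ofCenter, Heisenberg.ofVec, ← hkl, add_comm]
        · simp [Heisenberg.ofCenter, Heisenberg.ofVec]
      have h4 := hright k hk 1
      rw [one_mul] at h4
      rw [h3, (D (lagDelta ψ K)).2.1, (D (lagDelta ψ K)).2.2 l hl, h4, hD1, mul_zero]
    · rw [← K.orthogonal_inf L] at hv
      obtain ⟨i, ⟨hiK, hiL⟩, hi⟩ : ∃ i ∈ K.1.carrier ⊓ L.1.carrier, V.form i h.vec ≠ 0 := by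
        by_contra! hcon
        exact hv hcon
      exact lagModel_apply_eq_zero ψ hψ h2 _ hi (fun c => Submodule.smul_mem _ c hiL)
        fun c => hright _ (Submodule.smul_mem _ c hiK) h
  refine LinearMap.ext fun f => ?_
  have h7 := congrArg D (sum_smul_lagDelta ψ f)
  rw [map_smul, map_sum] at h7
  simp only [map_smul, hDi, hzero, map_zero, smul_zero, Finset.sum_const_zero] at h7
  exact (smul_eq_zero.1 h7).resolve_left (Nat.cast_ne_zero.2 Nat.card_pos.ne')

variable [Fintype F] [DecidableEq F]

/-- The normalized averaging map `H_{L°} → H_{M°}`. -/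
noncomputable def averaging (M L : OrientedLagrangian V) : lagModel ψ L →ₗ[ℂ] lagModel ψ M where
  toFun f := ⟨fun h => normConst ψ M L * ∑ᶠ m : M.1.carrier, f.1 (Heisenberg.ofVec m.1 * h), by
    constructor
    · intro z h
      have : ∀ m : M.1.carrier, f.1 (Heisenberg.ofVec m.1 * (Heisenberg.ofCenter z * h)) =
          ψ z * f.1 (Heisenberg.ofVec m.1 * h) := by
        intro m
        rw [← f.2.1]
        refine congrArg f.1 (Heisenberg.ext ?_ ?_)
        · simp [Heisenberg.ofCenter]
        · simp [Heisenberg.ofCenter, Heisenberg.ofVec, add_assoc]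
      simp only [this]
      rw [← mul_finsum]
      ring
    · intro l hl h
      refine congrArg (normConst ψ M L * ·) ?_
      refine finsum_eq_of_bijective (Equiv.addRight (⟨l, hl⟩ : M.1.carrier))
        (Equiv.bijective _) fun m => ?_
      rw [← mul_assoc]
      refine congrArg (fun k => f.1 (k * h)) (Heisenberg.ext ?_ ?_)
      · rfl
      · simp [Heisenberg.ofVec, M.form_eq_zero m.2 hl]⟩
  map_add' f g := by
    ext h
    change _ * ∑ᶠ m : M.1.carrier, (f.1 _ + g.1 _) = _ * ∑ᶠ m : M.1.carrier, f.1 _ +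
      _ * ∑ᶠ m : M.1.carrier, g.1 _
    rw [finsum_add_distrib (Set.toFinite _) (Set.toFinite _), mul_add]
  map_smul' c f := by
    ext h
    change _ * ∑ᶠ m : M.1.carrier, (c * f.1 _) = c * (_ * ∑ᶠ m : M.1.carrier, f.1 _)
    rw [← mul_finsum]
    ring

theorem averaging_apply (M L : OrientedLagrangian V) (f : lagModel ψ L) (h : Heisenberg V) :
    (averaging ψ M L f).1 h =
      normConst ψ M L * ∑ᶠ m : M.1.carrier, f.1 (Heisenberg.ofVec m.1 * h) := rfl

theorem averaging_intertwines (M L : OrientedLagrangian V) (h : Heisenberg V)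
    (f : lagModel ψ L) : averaging ψ M L (lagModelRep ψ L h f) =
      lagModelRep ψ M h (averaging ψ M L f) := by
  ext x
  rw [averaging_apply, lagModelRep_apply, averaging_apply]
  simp only [lagModelRep_apply, mul_assoc]

end Intertwiners

/-! ## The canonical system of intertwining maps -/

section CanonicalSystem

variable {F : Type w} [Field F] [Fintype F] [DecidableEq F] (ψ : AddChar F ℂ)
  {V : SympSpace.{w, u} F}

theorem averaging_lagDelta {K L : OrientedLagrangian V}
    (h : K.1.carrier ⊓ L.1.carrier = ⊥) :
    (averaging ψ L K (lagDelta ψ K)).1 1 = normConst ψ L K := by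
  rw [averaging_apply, finsum_eq_single _ 0]
  · rw [mul_one, lagDelta_of_mem ψ (K.1.carrier.zero_mem)]
    simp [Heisenberg.ofVec]
  · intro l hl
    rw [lagDelta_of_notMem ψ]
    intro hK
    have : (l : V) ∈ K.1.carrier ⊓ L.1.carrier := by
      refine ⟨?_, l.2⟩
      simpa [Heisenberg.ofVec] using hK
    rw [h, Submodule.mem_bot] at this
    exact hl (Subtype.ext this)

/-- The double sum over `L` and `N` is a sum over `V = L ⊕ N`, and the delta function selects the `l
+ n = k` in `K`. There `l` is the projection `P k` and the phase is `ω(n, l) / 2 = ω(k, P k) / 2`.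
Independence of the transfer allows `P` to be replaced by `T`. -/
theorem averaging_averaging_lagDelta (hF : ringChar F ≠ 2) (hψ : ψ ≠ 1)
    {K L N : OrientedLagrangian V} (hK : K.1.carrier ⊓ N.1.carrier = ⊥)
    (hL : L.1.carrier ⊓ N.1.carrier = ⊥) {T : V →ₗ[F] V}
    (hT : Transfers K.1.carrier L.1.carrier T) {c : F}
    (hc : ExteriorAlgebra.map T K.1.vec = c • L.1.vec) :
    (averaging ψ L N (averaging ψ N K (lagDelta ψ K))).1 1 =
      ((Fintype.card F : ℂ) ^ (finrank F V / 2))⁻¹ *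
        (quadSign F c * transferSum ψ K.1.carrier T) := by
  classical
  obtain ⟨P, hP, hPL, hPN⟩ := exists_transfer hK hL
  obtain ⟨d, hd⟩ := OrientedSubspace.exists_map_vec_eq hP.map_eq
    (by rw [K.finrank_eq, L.finrank_eq])
  rw [hT.sign_mul_sum_eq ψ hF hψ hP hc hd, ← mul_assoc,
    ← normConst_mul_normConst ψ hF hψ hL hP hPN hd, averaging_apply]
  simp only [averaging_apply, mul_one]
  rw [← mul_finsum, ← mul_assoc]
  congr 1
  let _ : Fintype V := Fintype.ofFinite V
  have : Finite K.1.carrier := Subtype.finite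
  have : Finite L.1.carrier := Subtype.finite
  have : Finite N.1.carrier := Subtype.finite
  let _ : Fintype K.1.carrier := Fintype.ofFinite _
  let _ : Fintype L.1.carrier := Fintype.ofFinite _
  let _ : Fintype N.1.carrier := Fintype.ofFinite _
  simp only [transferSum, finsum_eq_sum_of_fintype]
  rw [← Fintype.sum_prod_type', Fintype.sum_equiv
    (Submodule.prodEquivOfIsCompl _ _ (OrientedLagrangian.isCompl hL)).toEquiv _
    (fun v : V => if v ∈ K.1.carrier then ψ (2⁻¹ * V.form v (P v)) else 0)]
  · rw [← Finset.sum_filter]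
    exact (Finset.sum_subtype _ (by simp) _)
  · rintro ⟨l, n⟩
    change _ = if (l + n : V) ∈ K.1.carrier then ψ (2⁻¹ * V.form (l + n : V) (P (l + n : V))) else 0
    have hPl : P (l + n : V) = l := by
      have h1 : (l : V) - P (l + n : V) ∈ L.1.carrier ⊓ N.1.carrier := by
        refine ⟨sub_mem l.2 (hPL _), ?_⟩
        have := sub_mem (hPN (l + n : V)) n.2
        rwa [show (l : V) + n - P (l + n : V) - n = l - P (l + n : V) by abel] at this
      rw [hL, Submodule.mem_bot, sub_eq_zero] at h1
      exact h1.symm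
    have hvec : (Heisenberg.ofVec (n : V) * Heisenberg.ofVec (l : V)).vec = (l + n : V) :=
      add_comm _ _
    split_ifs with hK'
    · rw [lagDelta_of_mem ψ (by rw [hvec]; exact hK'), hPl, map_add, LinearMap.add_apply,
        V.isAlt.self_eq_zero, zero_add]
      simp [Heisenberg.ofVec]
    · rw [lagDelta_of_notMem ψ (by rw [hvec]; exact hK')]

/-- The canonical system of intertwining maps. -/
noncomputable def canonicalSystem (hF : ringChar F ≠ 2) (V : SympSpace.{w, u} F) :
    LagSystem ψ V := fun M L =>
  averaging ψ M (OrientedLagrangian.exists_transversal hF L M M).choose ∘ₗ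
    averaging ψ (OrientedLagrangian.exists_transversal hF L M M).choose L

theorem canonicalSystem_intertwines (hF : ringChar F ≠ 2) (M L : OrientedLagrangian V)
    (h : Heisenberg V) (f : lagModel ψ L) :
    canonicalSystem ψ hF V M L (lagModelRep ψ L h f) =
      lagModelRep ψ M h (canonicalSystem ψ hF V M L f) := by
  simp only [canonicalSystem, LinearMap.comp_apply, averaging_intertwines]

theorem canonicalSystem_lagDelta (hF : ringChar F ≠ 2) (hψ : ψ ≠ 1)
    {K L : OrientedLagrangian V} {T : V →ₗ[F] V}
    (hT : Transfers K.1.carrier L.1.carrier T) {c : F}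
    (hc : ExteriorAlgebra.map T K.1.vec = c • L.1.vec) :
    (canonicalSystem ψ hF V L K (lagDelta ψ K)).1 1 =
      ((Fintype.card F : ℂ) ^ (finrank F V / 2))⁻¹ *
        (quadSign F c * transferSum ψ K.1.carrier T) :=
  averaging_averaging_lagDelta ψ hF hψ
    (OrientedLagrangian.exists_transversal hF K L L).choose_spec.1
    (OrientedLagrangian.exists_transversal hF K L L).choose_spec.2.1 hT hc

/-- The value on the delta function does not mention `N`, so the chosen transversal in
`canonicalSystem` is immaterial. -/
theorem averaging_comp_averaging (hF : ringChar F ≠ 2) (hψ : ψ ≠ 1)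
    {K L N : OrientedLagrangian V} (hK : K.1.carrier ⊓ N.1.carrier = ⊥)
    (hL : L.1.carrier ⊓ N.1.carrier = ⊥) :
    averaging ψ L N ∘ₗ averaging ψ N K = canonicalSystem ψ hF V L K := by
  refine intertwiner_ext ψ hψ (Ring.two_ne_zero hF) (fun h f => ?_)
    (canonicalSystem_intertwines ψ hF L K) ?_
  · simp only [LinearMap.comp_apply, averaging_intertwines]
  · obtain ⟨T, c, hT, hc⟩ := exists_transfer_map_vec hF K L
    rw [canonicalSystem_lagDelta ψ hF hψ hT hc, LinearMap.comp_apply,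
      averaging_averaging_lagDelta ψ hF hψ hK hL hT hc]

theorem canonicalSystem_eq_averaging (hF : ringChar F ≠ 2) (hψ : ψ ≠ 1)
    {K L : OrientedLagrangian V} (h : K.1.carrier ⊓ L.1.carrier = ⊥) :
    canonicalSystem ψ hF V L K = averaging ψ L K := by
  refine intertwiner_ext ψ hψ (Ring.two_ne_zero hF) (canonicalSystem_intertwines ψ hF L K)
    (averaging_intertwines ψ L K) ?_
  obtain ⟨T, c, hT, hc⟩ := exists_transfer_map_vec hF K L
  rw [canonicalSystem_lagDelta ψ hF hψ hT hc, averaging_lagDelta ψ h,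
    hT.normConst_eq ψ hF hψ h hc]

theorem canonicalSystem_self (hF : ringChar F ≠ 2) (hψ : ψ ≠ 1) (K : OrientedLagrangian V) :
    canonicalSystem ψ hF V K K = LinearMap.id := by
  refine intertwiner_ext ψ hψ (Ring.two_ne_zero hF) (canonicalSystem_intertwines ψ hF K K)
    (fun _ _ => rfl) ?_
  have : Finite K.1.carrier := Subtype.finite
  let _ : Fintype K.1.carrier := Fintype.ofFinite _
  -- For `T = id` every summand is `1`, and the sum `|K| = q^n` cancels the normalization.
  rw [canonicalSystem_lagDelta ψ hF hψ (Transfers.refl K) (c := 1) (by simp), LinearMap.id_apply,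
    lagDelta_one, map_one, one_mul, transferSum]
  simp only [LinearMap.id_apply, V.isAlt.self_eq_zero, mul_zero, AddChar.map_zero_eq_one,
    finsum_eq_sum_of_fintype, Finset.sum_const, Finset.card_univ, nsmul_eq_mul, mul_one]
  rw [Module.card_eq_pow_finrank (K := F) (V := K.1.carrier), K.finrank_eq, Nat.cast_pow]
  exact inv_mul_cancel₀ (pow_ne_zero _ (Nat.cast_ne_zero.2 Fintype.card_ne_zero))

theorem canonicalSystem_isCanonical (hF : ringChar F ≠ 2) (hψ : ψ ≠ 1) :
    IsCanonicalSystem ψ (canonicalSystem ψ hF V) where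
  intertwines M L h := LinearMap.ext fun f => canonicalSystem_intertwines ψ hF M L h f
  restriction M L h f x := by rw [canonicalSystem_eq_averaging ψ hF hψ h]; rfl
  multiplicative N M L := by
    -- All three maps are factored through a common transversal `X`; in the composition the two
    -- inner averagings form `F_{X,X} = id`.
    obtain ⟨X, hN, hM, hL⟩ := OrientedLagrangian.exists_transversal hF N M L
    rw [← averaging_comp_averaging ψ hF hψ hM hN, ← averaging_comp_averaging ψ hF hψ hL hM,
      ← averaging_comp_averaging ψ hF hψ hL hN, LinearMap.comp_assoc,
      ← LinearMap.comp_assoc (averaging ψ X L), averaging_comp_averaging ψ hF hψ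
        (K := X) (L := X) (N := M) (by rwa [inf_comm]) (by rwa [inf_comm]),
      canonicalSystem_self ψ hF hψ, LinearMap.id_comp]

/-- The maps are prescribed on transversal pairs, and multiplicativity through a common transversal
determines the rest. -/
theorem IsCanonicalSystem.eq_canonicalSystem (hF : ringChar F ≠ 2) (hψ : ψ ≠ 1)
    {S : LagSystem ψ V} (hS : IsCanonicalSystem ψ S) : S = canonicalSystem ψ hF V := by
  have key : ∀ {K L : OrientedLagrangian V}, K.1.carrier ⊓ L.1.carrier = ⊥ →
      S L K = averaging ψ L K := fun h => by
    ext f x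
    rw [hS.restriction _ _ h, averaging_apply]
  funext M L
  obtain ⟨X, hM, hL, -⟩ := OrientedLagrangian.exists_transversal hF M L L
  rw [hS.multiplicative M X L, key hL, key (by rwa [inf_comm]),
    averaging_comp_averaging ψ hF hψ hL hM]

theorem existsUnique_isCanonicalSystem (hF : ringChar F ≠ 2) (hψ : ψ ≠ 1)
    (V : SympSpace.{w, u} F) : ∃! S : LagSystem ψ V, IsCanonicalSystem ψ S :=
  ⟨canonicalSystem ψ hF V, canonicalSystem_isCanonical ψ hF hψ,
    fun _ hS => hS.eq_canonicalSystem ψ hF hψ⟩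

theorem mem_canonicalSpace_iff (hF : ringChar F ≠ 2) (hψ : ψ ≠ 1)
    {v : ∀ L : OrientedLagrangian V, lagModel ψ L} :
    v ∈ canonicalSpace ψ V ↔ ∀ M L, canonicalSystem ψ hF V M L (v L) = v M :=
  ⟨fun h => h _ (canonicalSystem_isCanonical ψ hF hψ), fun h S hS => by
    rw [hS.eq_canonicalSystem ψ hF hψ]; exact h⟩

end CanonicalSystem

/-! ## Lagrangians of the symplectic reduction -/

section Wedge

variable {F : Type w} [Field F] {V : SympSpace.{w, u} F}

/-- The product is a wedge of `dim I + 1` vectors of `I`. -/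
theorem OrientedSubspace.vec_mul_ι (I : OrientedSubspace V) {i : V} (hi : i ∈ I.carrier) :
    I.vec * ExteriorAlgebra.ι F i = 0 := by
  have h : I.vec * ExteriorAlgebra.ι F i ∈
      (I.carrier.map (ExteriorAlgebra.ι F)) ^ (finrank F I.carrier + 1) := by
    rw [pow_succ]
    exact Submodule.mul_mem_mul I.vec_mem (Submodule.mem_map_of_mem hi)
  rw [top_eq_map, ← ExteriorAlgebra.ιMulti_span_fixedDegree] at h
  have hbot : Submodule.span F (Set.range
      (ExteriorAlgebra.ιMulti F (finrank F I.carrier + 1) (M := I.carrier))) = ⊥ := by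
    rw [Submodule.span_eq_bot]
    rintro _ ⟨v, rfl⟩
    refine AlternatingMap.map_linearDependent _ _ fun hv => ?_
    have := hv.fintype_card_le_finrank
    rw [Fintype.card_fin] at this
    omega
  rw [hbot, Submodule.map_bot, Submodule.mem_bot] at h
  exact h

theorem OrientedSubspace.vec_mul_mul_ι (I : OrientedSubspace V) (x : ExteriorAlgebra F V) :
    ∀ {i : V}, i ∈ I.carrier → I.vec * x * ExteriorAlgebra.ι F i = 0 := by
  induction x using CliffordAlgebra.right_induction with
  | algebraMap r =>
    intro i hi
    rw [mul_assoc, Algebra.commutes, ← mul_assoc, I.vec_mul_ι hi, zero_mul]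
  | add x y hx hy =>
    intro i hi
    rw [mul_add, add_mul, hx hi, hy hi, add_zero]
  | mul_ι m x hx =>
    intro i hi
    have h := ExteriorAlgebra.ι_add_mul_swap (R := F) m i
    have h' := eq_neg_of_add_eq_zero_left h
    change I.vec * (x * ExteriorAlgebra.ι F m) * ExteriorAlgebra.ι F i = 0
    rw [← mul_assoc, mul_assoc _ (ExteriorAlgebra.ι F m), h', mul_neg, ← mul_assoc, hx hi,
      zero_mul, neg_zero]

/-- Terms involving a vector of `I` die against `o_I`. Hence the orientation `o_I ∧ o_L` of a lifted
Lagrangian does not depend on the section used to lift `o_L`. -/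
theorem OrientedSubspace.vec_mul_map_congr (I : OrientedSubspace V) {W : Type*} [AddCommGroup W]
    [Module F W] {s s' : W →ₗ[F] V} (h : ∀ x, s x - s' x ∈ I.carrier) (y : ExteriorAlgebra F W) :
    I.vec * ExteriorAlgebra.map s y = I.vec * ExteriorAlgebra.map s' y := by
  induction y using CliffordAlgebra.right_induction with
  | algebraMap r =>
    change I.vec * ExteriorAlgebra.map s (algebraMap F (ExteriorAlgebra F W) r) =
      I.vec * ExteriorAlgebra.map s' (algebraMap F (ExteriorAlgebra F W) r)
    rw [AlgHom.commutes, AlgHom.commutes]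
  | add x y hx hy => rw [map_add, map_add, mul_add, mul_add, hx, hy]
  | mul_ι m x hx =>
    change I.vec * ExteriorAlgebra.map s (x * ExteriorAlgebra.ι F m) =
      I.vec * ExteriorAlgebra.map s' (x * ExteriorAlgebra.ι F m)
    rw [map_mul, map_mul, ← mul_assoc, ← mul_assoc, hx, ExteriorAlgebra.map_apply_ι,
      ExteriorAlgebra.map_apply_ι, ← sub_eq_zero, ← mul_sub, ← map_sub]
    exact I.vec_mul_mul_ι _ (h m)

theorem OrientedSubspace.map_vec_eq_self (I : OrientedSubspace V) {T : V →ₗ[F] V}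
    (hT : ∀ x ∈ I.carrier, T x = x) : ExteriorAlgebra.map T I.vec = I.vec := by
  obtain ⟨a, -, ha⟩ := I.exists_vec_eq (finBasis F I.carrier)
  rw [ha, map_smul, ExteriorAlgebra.map_apply_ιMulti]
  congr 2
  funext i
  exact hT _ (finBasis F I.carrier i).2

theorem two_mul_finrank_of_orthogonal_eq {L : Submodule F V} (hL : V.form.orthogonal L = L) :
    2 * finrank F L = finrank F V := by
  obtain ⟨J, rfl⟩ := OrientedSubspace.exists_carrier_eq L
  exact OrientedLagrangian.two_mul_finrank ⟨J, hL⟩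

end Wedge

namespace OrientedIsotropic

variable {F : Type w} [Field F] {V U : SympSpace.{w, u} F}

/-- The quotient map `I^⊥ → I^⊥ / I`. -/
def proj (I : OrientedIsotropic V) : I.perp →ₗ[F] I.reduction := I.inPerp.mkQ

theorem proj_surjective (I : OrientedIsotropic V) : Function.Surjective I.proj :=
  Submodule.mkQ_surjective _

theorem form_proj (I : OrientedIsotropic V) (x y : I.perp) :
    I.reduction.form (I.proj x) (I.proj y) = V.form x y := rfl

theorem proj_eq_zero (I : OrientedIsotropic V) {x : I.perp} :
    I.proj x = 0 ↔ (x : V) ∈ I.1.carrier := Submodule.Quotient.mk_eq_zero _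

/-- A linear section of `I^⊥ → I^⊥ / I`. -/
noncomputable def sec (I : OrientedIsotropic V) : I.reduction →ₗ[F] I.perp :=
  (LinearMap.exists_rightInverse_of_surjective I.proj
    (LinearMap.range_eq_top.2 I.proj_surjective)).choose

theorem proj_sec (I : OrientedIsotropic V) (x : I.reduction) : I.proj (I.sec x) = x :=
  LinearMap.congr_fun (LinearMap.exists_rightInverse_of_surjective I.proj
    (LinearMap.range_eq_top.2 I.proj_surjective)).choose_spec x

theorem form_sec (I : OrientedIsotropic V) (x y : I.reduction) :
    V.form (I.sec x) (I.sec y) = I.reduction.form x y := by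
  rw [← form_proj, proj_sec, proj_sec]

theorem sub_sec_mem (I : OrientedIsotropic V) (x : I.perp) :
    (x : V) - I.sec (I.proj x) ∈ I.1.carrier := by
  have : I.proj (x - I.sec (I.proj x)) = 0 := by rw [map_sub, proj_sec, sub_self]
  exact I.proj_eq_zero.1 this

theorem form_perp_eq_zero (I : OrientedIsotropic V) {x i : V} (hx : x ∈ I.perp)
    (hi : i ∈ I.1.carrier) : V.form x i = 0 := V.isAlt.isRefl _ _ (hx i hi)

/-- The preimage in `I^⊥` of a subspace of `I^⊥ / I`. -/
def liftSubmodule (I : OrientedIsotropic V) (L : Submodule F I.reduction) : Submodule F V :=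
  (L.comap I.proj).map I.perp.subtype

theorem mem_liftSubmodule (I : OrientedIsotropic V) {L : Submodule F I.reduction} {x : V} :
    x ∈ I.liftSubmodule L ↔ ∃ h : x ∈ I.perp, I.proj ⟨x, h⟩ ∈ L := by
  constructor
  · rintro ⟨y, hy, rfl⟩
    exact ⟨y.2, hy⟩
  · rintro ⟨h, hx⟩
    exact ⟨⟨x, h⟩, hx, rfl⟩

theorem coe_mem_liftSubmodule (I : OrientedIsotropic V) {L : Submodule F I.reduction}
    {x : I.perp} : (x : V) ∈ I.liftSubmodule L ↔ I.proj x ∈ L :=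
  I.mem_liftSubmodule.trans ⟨fun h => h.2, fun h => ⟨x.2, h⟩⟩

theorem le_liftSubmodule (I : OrientedIsotropic V) (L : Submodule F I.reduction) :
    I.1.carrier ≤ I.liftSubmodule L := by
  intro i hi
  refine I.mem_liftSubmodule.2 ⟨I.2 hi, ?_⟩
  rw [I.proj_eq_zero.2 hi]
  exact L.zero_mem

theorem sec_mem_liftSubmodule (I : OrientedIsotropic V) {L : Submodule F I.reduction}
    {x : I.reduction} : (I.sec x : V) ∈ I.liftSubmodule L ↔ x ∈ L := by
  rw [coe_mem_liftSubmodule, proj_sec]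

theorem orthogonal_liftSubmodule (I : OrientedIsotropic V) {L : Submodule F I.reduction}
    (hL : I.reduction.form.orthogonal L = L) :
    V.form.orthogonal (I.liftSubmodule L) = I.liftSubmodule L := by
  ext x
  constructor
  · intro hx
    have hxp : x ∈ I.perp := fun i hi => hx i (I.le_liftSubmodule L hi)
    refine I.mem_liftSubmodule.2 ⟨hxp, ?_⟩
    rw [← hL]
    intro y hy
    change I.reduction.form y _ = 0
    rw [← I.proj_sec y, form_proj]
    exact hx _ (I.sec_mem_liftSubmodule.2 hy)
  · intro hx y hy
    obtain ⟨hxp, hx'⟩ := I.mem_liftSubmodule.1 hx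
    obtain ⟨hyp, hy'⟩ := I.mem_liftSubmodule.1 hy
    rw [← hL] at hx'
    exact hx' _ hy'

theorem finrank_reduction (I : OrientedIsotropic V) :
    finrank F I.reduction + 2 * finrank F I.1.carrier = finrank F V := by
  have h1 := Submodule.finrank_quotient_add_finrank I.inPerp
  have h2 : finrank F I.inPerp = finrank F I.1.carrier :=
    (Submodule.submoduleOfEquivOfLe I.2).finrank_eq
  have h3 := LinearMap.BilinForm.finrank_orthogonal V.nondegenerate I.1.carrier
  have h4 := Submodule.finrank_le I.1.carrier
  change finrank F I.reduction + _ = _ at h1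
  change finrank F I.perp = _ at h3
  omega

theorem finrank_liftSubmodule (I : OrientedIsotropic V) {L : Submodule F I.reduction}
    (hL : I.reduction.form.orthogonal L = L) :
    finrank F (I.liftSubmodule L) = finrank F I.1.carrier + finrank F L := by
  have h1 := two_mul_finrank_of_orthogonal_eq hL
  have h2 := two_mul_finrank_of_orthogonal_eq (I.orthogonal_liftSubmodule hL)
  have h3 := I.finrank_reduction
  omega

/-- The section of `I^⊥ → I^⊥ / I` as a map to `V`. -/
noncomputable def secV (I : OrientedIsotropic V) : I.reduction →ₗ[F] V :=
  I.perp.subtype ∘ₗ I.sec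

theorem secV_apply (I : OrientedIsotropic V) (x : I.reduction) : I.secV x = I.sec x := rfl

/-- The image of the section meets `I` only in `0`, so a basis of `I` and a lifted basis of `L` are
jointly independent. -/
theorem vec_mul_map_ne_zero (I : OrientedIsotropic V) (L : OrientedSubspace I.reduction) :
    I.1.vec * ExteriorAlgebra.map I.secV L.vec ≠ 0 := by
  obtain ⟨a, ha, hI⟩ := I.1.exists_vec_eq (finBasis F I.1.carrier)
  obtain ⟨b, hb, hL⟩ := L.exists_vec_eq (finBasis F L.carrier)
  rw [hI, hL, map_smul, ExteriorAlgebra.map_apply_ιMulti, smul_mul_smul_comm,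
    ExteriorAlgebra.ιMulti_mul_ιMulti]
  refine smul_ne_zero (mul_ne_zero ha hb) (ExteriorAlgebra.ιMulti_ne_zero ?_)
  rw [← linearIndependent_equiv finSumFinEquiv]
  have hu : LinearIndependent F fun i => (finBasis F I.1.carrier i : V) :=
    (finBasis F I.1.carrier).linearIndependent.map' _ (Submodule.ker_subtype _)
  have hinj : Function.Injective I.secV := fun x y hxy => by
    rw [← I.proj_sec x, ← I.proj_sec y, Subtype.ext hxy]
  have hv : LinearIndependent F (I.secV ∘ fun i => (finBasis F L.carrier i : I.reduction)) :=
    ((finBasis F L.carrier).linearIndependent.map' _ (Submodule.ker_subtype _)).map' _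
      (LinearMap.ker_eq_bot.2 hinj)
  have hdisj : Disjoint
      (Submodule.span F (Set.range fun i => (finBasis F I.1.carrier i : V)))
      (Submodule.span F (Set.range (I.secV ∘ fun i => (finBasis F L.carrier i : I.reduction)))) := by
    rw [Submodule.disjoint_def]
    intro x hx hx'
    have h1 : x ∈ I.1.carrier := by
      refine Submodule.span_le.2 ?_ hx
      rintro _ ⟨i, rfl⟩
      exact (finBasis F I.1.carrier i).2
    have h2 : x ∈ LinearMap.range I.secV := by
      refine Submodule.span_le.2 ?_ hx'
      rintro _ ⟨i, rfl⟩
      exact ⟨_, rfl⟩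
    obtain ⟨y, rfl⟩ := h2
    have : y = 0 := by rw [← I.proj_sec y]; exact I.proj_eq_zero.2 h1
    rw [this, map_zero]
  have he : Fin.append (fun i => (finBasis F I.1.carrier i : V))
      (I.secV ∘ fun i => (finBasis F L.carrier i : I.reduction)) ∘ finSumFinEquiv =
      Sum.elim (fun i => (finBasis F I.1.carrier i : V))
        (I.secV ∘ fun i => (finBasis F L.carrier i : I.reduction)) := by
    ext (i | i) <;> simp
  rw [he]
  exact hu.sum_type hv hdisj

/-- The oriented Lagrangian of `V` containing `I` defined by an oriented Lagrangian of `I^⊥ / I`,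
with orientation `o_I ∧ o_L`. -/
noncomputable def lift (I : OrientedIsotropic V) (L : OrientedLagrangian I.reduction) :
    OrientedLagrangian V where
  val :=
    { carrier := I.liftSubmodule L.1.carrier
      vec := I.1.vec * ExteriorAlgebra.map I.secV L.1.vec
      vec_mem := by
        rw [I.finrank_liftSubmodule L.2, pow_add]
        refine Submodule.mul_mem_mul
          (pow_le_pow_left' (Submodule.map_mono (I.le_liftSubmodule _)) _ I.1.vec_mem) ?_
        have h : (L.1.carrier.map I.secV).map (ExteriorAlgebra.ι F) ≤
            (I.liftSubmodule L.1.carrier).map (ExteriorAlgebra.ι F) := by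
          refine Submodule.map_mono ?_
          rintro _ ⟨x, hx, rfl⟩
          exact I.sec_mem_liftSubmodule.2 hx
        refine pow_le_pow_left' h _ ?_
        rw [← Submodule.map_comp, ← ExteriorAlgebra.map_comp_ι, Submodule.map_comp,
          ← Submodule.map_pow]
        exact Submodule.mem_map_of_mem L.1.vec_mem
      vec_ne_zero := I.vec_mul_map_ne_zero L.1 }
  property := I.orthogonal_liftSubmodule L.2

theorem lift_vec (I : OrientedIsotropic V) (L : OrientedLagrangian I.reduction) :
    (I.lift L).1.vec = I.1.vec * ExteriorAlgebra.map I.secV L.1.vec := rfl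

theorem reductionIso_proj (f : SympSpace.Iso V U) {I : OrientedIsotropic V}
    {J : OrientedIsotropic U} (h : I.1.map f = J.1) (x : I.perp) :
    (reductionIso f h).toLinearEquiv (I.proj x) = J.proj (perpEquiv f h x) := rfl

theorem sec_reductionIso_sub_mem (f : SympSpace.Iso V U) {I : OrientedIsotropic V}
    {J : OrientedIsotropic U} (h : I.1.map f = J.1) (x : I.reduction) :
    (J.sec ((reductionIso f h).toLinearEquiv x) : U) - f.toLinearEquiv (I.sec x) ∈
      J.1.carrier := by
  have h1 : (reductionIso f h).toLinearEquiv x = J.proj (perpEquiv f h (I.sec x)) := by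
    rw [← reductionIso_proj, proj_sec]
  have h2 := J.sub_sec_mem (perpEquiv f h (I.sec x))
  rw [h1, ← neg_sub]
  exact neg_mem h2

/-- The image under `f` of the section for `I` is another section for `J`. The two differ by vectors
of `J`, which `o_J` annihilates. -/
theorem lift_map (f : SympSpace.Iso V U) {I : OrientedIsotropic V}
    {J : OrientedIsotropic U} (h : I.1.map f = J.1) (L : OrientedLagrangian I.reduction) :
    J.lift (L.map (reductionIso f h)) = (I.lift L).map f := by
  have hL : J.liftSubmodule (L.1.carrier.map (reductionIso f h).toLinearEquiv.toLinearMap) =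
      (I.liftSubmodule L.1.carrier).map f.toLinearEquiv.toLinearMap := by
    ext y
    constructor
    · intro hy
      obtain ⟨hyp, x, hx, hxy⟩ := J.mem_liftSubmodule.1 hy
      refine ⟨f.toLinearEquiv.symm y, ?_, f.toLinearEquiv.apply_symm_apply y⟩
      have h1 : f.toLinearEquiv.symm y = ((perpEquiv f h).symm ⟨y, hyp⟩ : I.perp) := rfl
      rw [h1]
      refine I.coe_mem_liftSubmodule.2 ?_
      have h2 : (reductionIso f h).toLinearEquiv (I.proj ((perpEquiv f h).symm ⟨y, hyp⟩)) =
          (reductionIso f h).toLinearEquiv x := by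
        rw [reductionIso_proj, LinearEquiv.apply_symm_apply]
        exact hxy.symm
      rw [(reductionIso f h).toLinearEquiv.injective h2]
      exact hx
    · rintro ⟨x, hx, rfl⟩
      obtain ⟨hxp, hx'⟩ := I.mem_liftSubmodule.1 hx
      have : f.toLinearEquiv x = (perpEquiv f h ⟨x, hxp⟩ : U) := rfl
      change f.toLinearEquiv x ∈ _
      rw [this]
      exact J.coe_mem_liftSubmodule.2 ⟨_, hx', rfl⟩
  refine Subtype.ext (OrientedSubspace.ext hL ?_)
  change J.1.vec * ExteriorAlgebra.map J.secV
    (ExteriorAlgebra.map (reductionIso f h).toLinearEquiv.toLinearMap L.1.vec) =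
    ExteriorAlgebra.map f.toLinearEquiv.toLinearMap
      (I.1.vec * ExteriorAlgebra.map I.secV L.1.vec)
  have hv : ExteriorAlgebra.map f.toLinearEquiv.toLinearMap I.1.vec = J.1.vec := by rw [← h]; rfl
  rw [map_mul, hv, ← AlgHom.comp_apply, ← AlgHom.comp_apply, ExteriorAlgebra.map_comp_map,
    ExteriorAlgebra.map_comp_map]
  exact J.1.vec_mul_map_congr (fun x => sec_reductionIso_sub_mem f h x) _

/-- A transfer between Lagrangians of `I^⊥ / I` lifts to a transfer between their preimages. -/
theorem exists_lift_transfer (I : OrientedIsotropic V) {K L : OrientedLagrangian I.reduction}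
    {T : I.reduction →ₗ[F] I.reduction} (hT : Transfers K.1.carrier L.1.carrier T) {c : F}
    (hc : ExteriorAlgebra.map T K.1.vec = c • L.1.vec) :
    ∃ T' : V →ₗ[F] V, Transfers (I.lift K).1.carrier (I.lift L).1.carrier T' ∧
      ExteriorAlgebra.map T' (I.lift K).1.vec = c • (I.lift L).1.vec ∧
      ∀ x y : I.perp, V.form x (T' y) = I.reduction.form (I.proj x) (T (I.proj y)) := by
  -- Along the splitting of `I^⊥` given by the section, `g` acts as `T` on the quotient part and as
  -- the identity on `I`.
  let g : I.perp →ₗ[F] I.perp := I.sec ∘ₗ T ∘ₗ I.proj + (LinearMap.id - I.sec ∘ₗ I.proj)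
  have hg : ∀ x, g x = I.sec (T (I.proj x)) + (x - I.sec (I.proj x)) := fun _ => rfl
  have hproj : ∀ x, I.proj (g x) = T (I.proj x) := fun x => by
    rw [hg, map_add, map_sub, proj_sec, proj_sec, sub_self, add_zero]
  obtain ⟨T', hT'⟩ := LinearMap.exists_extend (I.perp.subtype ∘ₗ g)
  have hT'g : ∀ x : I.perp, T' x = g x := fun x => LinearMap.congr_fun hT' x
  have hform : ∀ x y : I.perp, V.form x (T' y) = I.reduction.form (I.proj x) (T (I.proj y)) := by
    intro x y
    rw [hT'g, ← form_proj, hproj]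
  refine ⟨T', ⟨?_, ?_, ?_⟩, ?_, hform⟩
  · ext y
    constructor
    · rintro ⟨x, hx, rfl⟩
      obtain ⟨hxp, hx'⟩ := I.mem_liftSubmodule.1 hx
      rw [hT'g ⟨x, hxp⟩]
      refine I.coe_mem_liftSubmodule.2 ?_
      rw [hproj, ← hT.map_eq]
      exact Submodule.mem_map_of_mem hx'
    · intro hy
      obtain ⟨hyp, hy'⟩ := I.mem_liftSubmodule.1 hy
      rw [← hT.map_eq] at hy'
      obtain ⟨x, hx, hxy⟩ := hy'
      -- The preimage combines a lift of `x` with the component of `y` in `I`.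
      let z : I.perp := I.sec x + (⟨y, hyp⟩ - I.sec (I.proj ⟨y, hyp⟩))
      have hz : I.proj z = x := by
        simp only [z, map_add, map_sub, proj_sec, sub_self, add_zero]
      refine ⟨z, I.coe_mem_liftSubmodule.2 (by rw [hz]; exact hx), ?_⟩
      rw [hT'g, hg, hz, hxy]
      simp [z]
  · intro x hx hx'
    obtain ⟨hxp, hxK⟩ := I.mem_liftSubmodule.1 hx
    obtain ⟨_, hxL⟩ := I.mem_liftSubmodule.1 hx'
    rw [hT'g ⟨x, hxp⟩, hg, hT.fix _ hxK hxL]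
    simp
  · intro x hx y hy
    obtain ⟨hxp, hxK⟩ := I.mem_liftSubmodule.1 hx
    obtain ⟨hyp, hyK⟩ := I.mem_liftSubmodule.1 hy
    rw [hform ⟨x, hxp⟩ ⟨y, hyp⟩, hform ⟨y, hyp⟩ ⟨x, hxp⟩]
    exact hT.symm _ hxK _ hyK
  -- The factor `o_I` is fixed and the factor `o_K` is transported by `T`, so the scalar `c` is
  -- unchanged.
  · have h1 : ExteriorAlgebra.map T' I.1.vec = I.1.vec := by
      refine I.1.map_vec_eq_self fun x hx => ?_
      have h0 : I.proj ⟨x, I.2 hx⟩ = 0 := I.proj_eq_zero.2 hx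
      rw [hT'g ⟨x, I.2 hx⟩, hg, h0]
      simp
    have h2 : T' ∘ₗ I.secV = I.secV ∘ₗ T := by
      ext x
      change T' (I.sec x : V) = (I.sec (T x) : V)
      rw [hT'g, hg, proj_sec, sub_self, add_zero]
    rw [lift_vec, lift_vec, map_mul, h1, ← AlgHom.comp_apply, ExteriorAlgebra.map_comp_map, h2,
      ← ExteriorAlgebra.map_comp_map, AlgHom.comp_apply, hc, map_smul, mul_smul_comm]

end OrientedIsotropic

/-! ## Restriction of the models to the symplectic reduction -/

namespace OrientedIsotropic

section Models

variable {F : Type w} [Field F] (ψ : AddChar F ℂ) {V U : SympSpace.{w, u} F}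

/-- The section of `I^⊥ / I` as a homomorphism of Heisenberg groups. -/
noncomputable def heisenbergSec (I : OrientedIsotropic V) :
    Heisenberg I.reduction →* Heisenberg V where
  toFun h := ⟨I.secV h.vec, h.z⟩
  map_one' := by ext <;> simp
  map_mul' a b := by
    ext
    · simp
    · simp [secV_apply, form_sec]

@[simp] theorem heisenbergSec_vec (I : OrientedIsotropic V) (h : Heisenberg I.reduction) :
    (I.heisenbergSec h).vec = I.sec h.vec := rfl
@[simp] theorem heisenbergSec_z (I : OrientedIsotropic V) (h : Heisenberg I.reduction) :
    (I.heisenbergSec h).z = h.z := rfl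

theorem heisenbergSec_ofVec (I : OrientedIsotropic V) (x : I.reduction) :
    I.heisenbergSec (Heisenberg.ofVec x) = Heisenberg.ofVec (I.sec x : V) := rfl

theorem heisenbergSec_ofCenter (I : OrientedIsotropic V) (z : F) :
    I.heisenbergSec (Heisenberg.ofCenter z) = Heisenberg.ofCenter z := by
  ext <;> simp [Heisenberg.ofCenter]

/-- Restriction of functions from `H(V)` to `H(I^⊥ / I)`. -/
noncomputable def restrictModel (I : OrientedIsotropic V) (L : OrientedLagrangian I.reduction) :
    lagModel ψ (I.lift L) →ₗ[ℂ] lagModel ψ L where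
  toFun f := ⟨fun h => f.1 (I.heisenbergSec h),
    fun z h => by
      simpa only [map_mul, heisenbergSec_ofCenter] using f.2.1 z (I.heisenbergSec h),
    fun l hl h => by
      simpa only [map_mul, heisenbergSec_ofVec] using
        f.2.2 (I.sec l) (I.sec_mem_liftSubmodule.2 hl) (I.heisenbergSec h)⟩
  map_add' _ _ := rfl
  map_smul' _ _ := rfl

theorem restrictModel_apply (I : OrientedIsotropic V) (L : OrientedLagrangian I.reduction)
    (f : lagModel ψ (I.lift L)) (h : Heisenberg I.reduction) :
    (I.restrictModel ψ L f).1 h = f.1 (I.heisenbergSec h) := rfl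

/-- The function on `H(V)` that vanishes outside `I^⊥ × F` and is inflated from `g` there. -/
noncomputable def extendFun (I : OrientedIsotropic V) (g : Heisenberg I.reduction → ℂ) :
    Heisenberg V → ℂ :=
  open Classical in
  fun h => if hh : h.vec ∈ I.perp then g ⟨I.proj ⟨h.vec, hh⟩, h.z⟩ else 0

theorem extendFun_of_mem (I : OrientedIsotropic V) (g : Heisenberg I.reduction → ℂ)
    {h : Heisenberg V} (hh : h.vec ∈ I.perp) :
    I.extendFun g h = g ⟨I.proj ⟨h.vec, hh⟩, h.z⟩ := dif_pos hh

theorem extendFun_of_notMem (I : OrientedIsotropic V) (g : Heisenberg I.reduction → ℂ)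
    {h : Heisenberg V} (hh : h.vec ∉ I.perp) : I.extendFun g h = 0 := dif_neg hh

theorem extendFun_mem (I : OrientedIsotropic V) (L : OrientedLagrangian I.reduction)
    (g : lagModel ψ L) : I.extendFun g.1 ∈ lagModel ψ (I.lift L) := by
  constructor
  · intro z h
    have hv : (Heisenberg.ofCenter z * h).vec = h.vec := zero_add _
    by_cases hh : h.vec ∈ I.perp
    · rw [extendFun_of_mem I _ hh, extendFun_of_mem I _ (by rw [hv]; exact hh), ← g.2.1]
      refine congrArg g.1 (Heisenberg.ext ?_ ?_)
      · simp [Heisenberg.ofCenter]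
      · simp [Heisenberg.ofCenter]
    · rw [extendFun_of_notMem I _ hh, extendFun_of_notMem I _ (by rw [hv]; exact hh), mul_zero]
  · intro l hl h
    obtain ⟨hlp, hl'⟩ := I.mem_liftSubmodule.1 hl
    by_cases hh : h.vec ∈ I.perp
    · rw [extendFun_of_mem I _ hh,
        extendFun_of_mem I (h := Heisenberg.ofVec l * h) _ (add_mem hlp hh),
        ← g.2.2 _ hl' ⟨I.proj ⟨h.vec, hh⟩, h.z⟩]
      refine congrArg g.1 (Heisenberg.ext ?_ ?_)
      · exact map_add I.proj ⟨l, hlp⟩ ⟨h.vec, hh⟩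
      · simp [Heisenberg.ofVec, form_proj]
    · rw [extendFun_of_notMem I _ hh, extendFun_of_notMem I]
      exact fun h' => hh ((Submodule.add_mem_iff_right _ hlp).1 h')

/-- Extension by zero of functions inflated from `H(I^⊥ / I)`. -/
noncomputable def extendModel (I : OrientedIsotropic V) (L : OrientedLagrangian I.reduction) :
    lagModel ψ L →ₗ[ℂ] lagModel ψ (I.lift L) where
  toFun g := ⟨I.extendFun g.1, I.extendFun_mem ψ L g⟩
  map_add' f g := by
    ext h
    change I.extendFun (f.1 + g.1) h = I.extendFun f.1 h + I.extendFun g.1 h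
    by_cases hh : h.vec ∈ I.perp
    · simp only [extendFun_of_mem I _ hh, Pi.add_apply]
    · simp only [extendFun_of_notMem I _ hh, add_zero]
  map_smul' c f := by
    ext h
    change I.extendFun (c • f.1) h = c * I.extendFun f.1 h
    by_cases hh : h.vec ∈ I.perp
    · simp only [extendFun_of_mem I _ hh, Pi.smul_apply, smul_eq_mul]
    · simp only [extendFun_of_notMem I _ hh, mul_zero]

theorem extendModel_apply (I : OrientedIsotropic V) (L : OrientedLagrangian I.reduction)
    (g : lagModel ψ L) : (I.extendModel ψ L g).1 = I.extendFun g.1 := rfl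

theorem restrictModel_rep (I : OrientedIsotropic V) (L : OrientedLagrangian I.reduction)
    (k : Heisenberg I.reduction) (f : lagModel ψ (I.lift L)) :
    I.restrictModel ψ L (lagModelRep ψ _ (I.heisenbergSec k) f) =
      lagModelRep ψ L k (I.restrictModel ψ L f) := by
  ext h
  change f.1 (I.heisenbergSec h * I.heisenbergSec k) = f.1 (I.heisenbergSec (h * k))
  rw [map_mul]

theorem extendModel_rep (I : OrientedIsotropic V) (L : OrientedLagrangian I.reduction)
    (k : Heisenberg I.reduction) (g : lagModel ψ L) :
    I.extendModel ψ L (lagModelRep ψ L k g) =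
      lagModelRep ψ _ (I.heisenbergSec k) (I.extendModel ψ L g) := by
  ext h
  rw [lagModelRep_apply, extendModel_apply, extendModel_apply]
  by_cases hh : h.vec ∈ I.perp
  · rw [extendFun_of_mem I _ hh, extendFun_of_mem I (h := h * I.heisenbergSec k) _
      (add_mem hh (I.sec k.vec).2), lagModelRep_apply]
    refine congrArg g.1 (Heisenberg.ext ?_ ?_)
    · refine Eq.trans ?_ (map_add I.proj ⟨h.vec, hh⟩ (I.sec k.vec)).symm
      rw [proj_sec]
      rfl
    · rw [Heisenberg.mul_z, Heisenberg.mul_z, heisenbergSec_vec, heisenbergSec_z]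
      conv_lhs => rw [← I.proj_sec k.vec, form_proj]
  · rw [extendFun_of_notMem I _ hh, extendFun_of_notMem I]
    exact fun h' => hh ((Submodule.add_mem_iff_left _ (I.sec k.vec).2).1 h')

theorem extendModel_lagDelta (I : OrientedIsotropic V) (L : OrientedLagrangian I.reduction) :
    I.extendModel ψ L (lagDelta ψ L) = lagDelta ψ (I.lift L) := by
  ext h
  rw [extendModel_apply]
  by_cases hh : h.vec ∈ I.perp
  · rw [extendFun_of_mem I _ hh]
    by_cases hL : I.proj ⟨h.vec, hh⟩ ∈ L.1.carrier
    · rw [lagDelta_of_mem ψ hL, lagDelta_of_mem ψ (I.mem_liftSubmodule.2 ⟨hh, hL⟩)]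
    · rw [lagDelta_of_notMem ψ hL, lagDelta_of_notMem ψ
        fun h' => hL (I.mem_liftSubmodule.1 h').2]
  · rw [extendFun_of_notMem I _ hh, lagDelta_of_notMem ψ
      fun h' => hh (I.mem_liftSubmodule.1 h').1]

theorem extendModel_invariant (I : OrientedIsotropic V) (L : OrientedLagrangian I.reduction)
    (g : lagModel ψ L) {i : V} (hi : i ∈ I.1.carrier) :
    lagModelRep ψ _ (Heisenberg.ofVec i) (I.extendModel ψ L g) = I.extendModel ψ L g := by
  ext h
  rw [lagModelRep_apply, extendModel_apply]
  by_cases hh : h.vec ∈ I.perp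
  · rw [extendFun_of_mem I _ hh, extendFun_of_mem I (h := h * Heisenberg.ofVec i) _
      (add_mem hh (I.2 hi))]
    refine congrArg g.1 (Heisenberg.ext ?_ ?_)
    · refine (map_add I.proj ⟨h.vec, hh⟩ ⟨i, I.2 hi⟩).trans ?_
      rw [(I.proj_eq_zero (x := ⟨i, I.2 hi⟩)).2 hi, add_zero]
    · simp [Heisenberg.ofVec, I.form_perp_eq_zero hh hi]
  · rw [extendFun_of_notMem I _ hh, extendFun_of_notMem I]
    exact fun h' => hh ((Submodule.add_mem_iff_left _ (I.2 hi)).1 h')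

/-- Vectors of `I` also lie in the lifted Lagrangian, so invariance on both sides forces `f` to
vanish off `I^⊥ × F`. On `I^⊥ × F`, right translation by an element of `I` moves `h` to the chosen
representative of its class without a phase. -/
theorem extendModel_restrictModel (hψ : ψ ≠ 1) (h2 : (2 : F) ≠ 0) (I : OrientedIsotropic V)
    (L : OrientedLagrangian I.reduction) {f : lagModel ψ (I.lift L)}
    (hf : ∀ i ∈ I.1.carrier, lagModelRep ψ _ (Heisenberg.ofVec i) f = f) :
    I.extendModel ψ L (I.restrictModel ψ L f) = f := by
  have hf' : ∀ i ∈ I.1.carrier, ∀ h, f.1 (h * Heisenberg.ofVec i) = f.1 h := fun i hi h => by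
    rw [← lagModelRep_apply, hf i hi]
  ext h
  rw [extendModel_apply]
  by_cases hh : h.vec ∈ I.perp
  · rw [extendFun_of_mem I _ hh, restrictModel_apply, ← hf' _ (I.sub_sec_mem ⟨h.vec, hh⟩)]
    refine congrArg f.1 (Heisenberg.ext ?_ ?_)
    · simp [Heisenberg.ofVec]
    · have := I.form_perp_eq_zero (I.sec (I.proj ⟨h.vec, hh⟩)).2 (I.sub_sec_mem ⟨h.vec, hh⟩)
      simp only [Heisenberg.mul_z, heisenbergSec_vec, heisenbergSec_z, Heisenberg.ofVec, add_zero]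
      rw [this, mul_zero, add_zero]
  · rw [extendFun_of_notMem I _ hh]
    obtain ⟨i, hi, hne⟩ : ∃ i ∈ I.1.carrier, V.form i h.vec ≠ 0 := by
      by_contra! hcon
      exact hh hcon
    exact (lagModel_apply_eq_zero ψ hψ h2 f hne (fun c => (I.le_liftSubmodule _)
      (I.1.carrier.smul_mem c hi)) fun c => hf' _ (I.1.carrier.smul_mem c hi) h).symm

/-- The summand depends only on the class modulo `I`, and every fibre has `q^(dim I)` elements. -/
theorem transferSum_lift [Fintype F] (I : OrientedIsotropic V) (K : OrientedLagrangian I.reduction)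
    {T : I.reduction →ₗ[F] I.reduction} {T' : V →ₗ[F] V}
    (hT' : ∀ x y : I.perp, V.form x (T' y) = I.reduction.form (I.proj x) (T (I.proj y))) :
    transferSum ψ (I.lift K).1.carrier T' =
      (Fintype.card F : ℂ) ^ finrank F I.1.carrier * transferSum ψ K.1.carrier T := by
  have : Finite I.1.carrier := Subtype.finite
  have : Finite K.1.carrier := Subtype.finite
  have : Finite (I.lift K).1.carrier := Subtype.finite
  let _ : Fintype I.1.carrier := Fintype.ofFinite _
  let _ : Fintype K.1.carrier := Fintype.ofFinite _
  let _ : Fintype (I.lift K).1.carrier := Fintype.ofFinite _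
  have hp : ∀ x : (I.lift K).1.carrier, (x : V) ∈ I.perp :=
    fun x => (I.mem_liftSubmodule.1 x.2).1
  have hK : ∀ x : (I.lift K).1.carrier, I.proj ⟨x, hp x⟩ ∈ K.1.carrier :=
    fun x => (I.mem_liftSubmodule.1 x.2).2
  let e : (I.lift K).1.carrier ≃ I.1.carrier × K.1.carrier :=
    { toFun := fun x => (⟨_, I.sub_sec_mem ⟨x, hp x⟩⟩, ⟨_, hK x⟩)
      invFun := fun y => ⟨y.1 + I.sec y.2, add_mem (I.le_liftSubmodule _ y.1.2)
        (I.sec_mem_liftSubmodule.2 y.2.2)⟩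
      left_inv := fun x => Subtype.ext (sub_add_cancel _ _)
      right_inv := fun y => by
        have h : I.proj (⟨y.1, I.2 y.1.2⟩ + I.sec y.2) = y.2 := by
          rw [map_add, proj_sec, I.proj_eq_zero.2 y.1.2, zero_add]
        refine Prod.ext (Subtype.ext ?_) (Subtype.ext h)
        change (y.1 + I.sec y.2 : V) - I.sec (I.proj (⟨y.1, I.2 y.1.2⟩ + I.sec y.2)) = y.1
        rw [h, add_sub_cancel_right] }
  simp only [transferSum, finsum_eq_sum_of_fintype]
  rw [Fintype.sum_equiv e _ (fun y => ψ (2⁻¹ * I.reduction.form y.2.1 (T y.2.1)))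
    (fun x => by rw [hT' ⟨x, hp x⟩ ⟨x, hp x⟩]; rfl), Fintype.sum_prod_type]
  simp only [Finset.sum_const, nsmul_eq_mul, Finset.card_univ]
  rw [Module.card_eq_pow_finrank (K := F) (V := I.1.carrier), Nat.cast_pow]

end Models

/-! ### Compatibility of canonical systems with reduction, and naturality -/

section Canonical

variable {F : Type w} [Field F] [Fintype F] [DecidableEq F] (ψ : AddChar F ℂ)
  {V U : SympSpace.{w, u} F}

/-- A transfer and its lift have the same `c`. The extra factor `q^(dim I)` of the lifted Gauss sum
cancels against the normalization, since half the dimension also grows by `dim I`. -/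
theorem canonicalSystem_lift_lagDelta (hF : ringChar F ≠ 2) (hψ : ψ ≠ 1)
    (I : OrientedIsotropic V) (K L : OrientedLagrangian I.reduction) :
    (canonicalSystem ψ hF V (I.lift L) (I.lift K) (lagDelta ψ (I.lift K))).1 1 =
      (canonicalSystem ψ hF I.reduction L K (lagDelta ψ K)).1 1 := by
  obtain ⟨T, c, hT, hc⟩ := exists_transfer_map_vec hF K L
  obtain ⟨T', hT', hc', hform⟩ := I.exists_lift_transfer hT hc
  rw [canonicalSystem_lagDelta ψ hF hψ hT hc, canonicalSystem_lagDelta ψ hF hψ hT' hc',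
    I.transferSum_lift ψ K hform]
  have hn : finrank F V / 2 = finrank F I.reduction / 2 + finrank F I.1.carrier := by
    have := I.finrank_reduction
    omega
  have hq : (Fintype.card F : ℂ) ≠ 0 := Nat.cast_ne_zero.2 Fintype.card_ne_zero
  rw [hn, pow_add]
  field_simp

/-- The canonical system of `I^⊥ / I` is the restriction of the canonical system of `V`. -/
theorem restrictModel_canonicalSystem_extendModel (hF : ringChar F ≠ 2) (hψ : ψ ≠ 1)
    (I : OrientedIsotropic V) (K L : OrientedLagrangian I.reduction) (g : lagModel ψ K) :
    I.restrictModel ψ L (canonicalSystem ψ hF V (I.lift L) (I.lift K) (I.extendModel ψ K g)) =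
      canonicalSystem ψ hF I.reduction L K g := by
  have : I.restrictModel ψ L ∘ₗ canonicalSystem ψ hF V (I.lift L) (I.lift K) ∘ₗ
      I.extendModel ψ K = canonicalSystem ψ hF I.reduction L K := by
    -- The composite commutes with the Heisenberg group of `I^⊥ / I`, and extension by zero sends
    -- the delta function of `K` to that of its lift, so one value decides.
    refine intertwiner_ext ψ hψ (Ring.two_ne_zero hF) (fun h f => ?_)
      (canonicalSystem_intertwines ψ hF L K) ?_
    · simp only [LinearMap.comp_apply, extendModel_rep, canonicalSystem_intertwines,
        restrictModel_rep]
    · rw [← I.canonicalSystem_lift_lagDelta ψ hF hψ, LinearMap.comp_apply, LinearMap.comp_apply,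
        restrictModel_apply, map_one, extendModel_lagDelta]
  exact LinearMap.congr_fun this g

theorem invariantVectors_apply {I : OrientedIsotropic V} (v : invariantVectors ψ I)
    (L : OrientedLagrangian V) {i : V} (hi : i ∈ I.1.carrier) :
    lagModelRep ψ L (Heisenberg.ofVec i) (v.1.1 L) = v.1.1 L :=
  congrArg (fun t : canonicalSpace ψ V => t.1 L) (v.2 i hi)

/-- The map `H(V)^I → H(I^⊥ / I)`. -/
noncomputable def reductionMap (hF : ringChar F ≠ 2) (hψ : ψ ≠ 1) (I : OrientedIsotropic V) :
    invariantVectors ψ I →ₗ[ℂ] canonicalSpace ψ I.reduction where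
  toFun v := ⟨fun L => I.restrictModel ψ L (v.1.1 (I.lift L)), by
    rw [mem_canonicalSpace_iff ψ hF hψ]
    intro M L
    rw [← I.restrictModel_canonicalSystem_extendModel ψ hF hψ,
      I.extendModel_restrictModel ψ hψ (Ring.two_ne_zero hF) L
        (fun i hi => invariantVectors_apply ψ v _ hi),
      (mem_canonicalSpace_iff ψ hF hψ).1 v.1.2]⟩
  map_add' _ _ := rfl
  map_smul' _ _ := rfl

/-- A vector of a canonical space is determined by any one component, so a single Lagrangian `L`
suffices. For surjectivity, extend the component at `L` by zero and propagate it by the canonical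
system of `V`. -/
theorem reductionMap_bijective (hF : ringChar F ≠ 2) (hψ : ψ ≠ 1) (I : OrientedIsotropic V) :
    Function.Bijective (I.reductionMap ψ hF hψ) := by
  obtain ⟨L⟩ := OrientedLagrangian.nonempty I.reduction
  constructor
  · intro v w hvw
    have h1 : I.restrictModel ψ L (v.1.1 (I.lift L)) = I.restrictModel ψ L (w.1.1 (I.lift L)) :=
      congrArg (fun t : canonicalSpace ψ I.reduction => t.1 L) hvw
    have h2 : v.1.1 (I.lift L) = w.1.1 (I.lift L) := by
      rw [← I.extendModel_restrictModel ψ hψ (Ring.two_ne_zero hF) L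
        (fun i hi => invariantVectors_apply ψ v _ hi), h1,
        I.extendModel_restrictModel ψ hψ (Ring.two_ne_zero hF) L
        (fun i hi => invariantVectors_apply ψ w _ hi)]
    refine Subtype.ext (Subtype.ext (funext fun M => ?_))
    rw [← (mem_canonicalSpace_iff ψ hF hψ).1 v.1.2 M (I.lift L), h2,
      (mem_canonicalSpace_iff ψ hF hψ).1 w.1.2 M (I.lift L)]
  · intro x
    have hcan := canonicalSystem_isCanonical (V := V) ψ hF hψ
    let f := I.extendModel ψ L (x.1 L)
    let v : canonicalSpace ψ V := ⟨fun M => canonicalSystem ψ hF V M (I.lift L) f, by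
      rw [mem_canonicalSpace_iff ψ hF hψ]
      intro N M
      rw [← LinearMap.comp_apply, ← hcan.multiplicative]⟩
    have hv : v ∈ invariantVectors ψ I := by
      intro i hi
      refine Subtype.ext (funext fun M => ?_)
      change lagModelRep ψ M (Heisenberg.ofVec i) (canonicalSystem ψ hF V M (I.lift L) f) =
        canonicalSystem ψ hF V M (I.lift L) f
      rw [← canonicalSystem_intertwines, I.extendModel_invariant ψ L _ hi]
    refine ⟨⟨v, hv⟩, Subtype.ext (funext fun M => ?_)⟩
    change I.restrictModel ψ M (canonicalSystem ψ hF V (I.lift M) (I.lift L) f) = x.1 M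
    rw [I.restrictModel_canonicalSystem_extendModel ψ hF hψ,
      (mem_canonicalSpace_iff ψ hF hψ).1 x.2]

/-- The isomorphism `H(V)^I ≃ H(I^⊥ / I)`. -/
noncomputable def reductionEquiv (hF : ringChar F ≠ 2) (hψ : ψ ≠ 1) (I : OrientedIsotropic V) :
    invariantVectors ψ I ≃ₗ[ℂ] canonicalSpace ψ I.reduction :=
  LinearEquiv.ofBijective (I.reductionMap ψ hF hψ) (I.reductionMap_bijective ψ hF hψ)

/-- By `lift_map` both sides evaluate the same component of `v`, at points that differ by right
translation by an element of `J`, under which `v` is invariant. -/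
theorem reductionEquiv_natural (hF : ringChar F ≠ 2) (hψ : ψ ≠ 1) (f : SympSpace.Iso V U)
    {I : OrientedIsotropic V} {J : OrientedIsotropic U} (h : I.1.map f = J.1) :
    canonicalMap ψ (reductionIso f h) ∘ₗ (J.reductionEquiv ψ hF hψ).toLinearMap =
      (I.reductionEquiv ψ hF hψ).toLinearMap ∘ₗ invariantMap ψ f h := by
  ext v L x
  change (v.1.1 (J.lift (L.map (reductionIso f h)))).1
      (J.heisenbergSec (Heisenberg.map (reductionIso f h) x)) =
    (v.1.1 ((I.lift L).map f)).1 (Heisenberg.map f (I.heisenbergSec x))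
  rw [section_congr ψ v.1.1 (lift_map f h L)]
  have hj := sec_reductionIso_sub_mem f h x.vec
  have hinv := congrArg
    (fun g : lagModel ψ ((I.lift L).map f) => g.1 (Heisenberg.map f (I.heisenbergSec x)))
    (invariantVectors_apply ψ v ((I.lift L).map f) hj)
  refine Eq.trans ?_ hinv
  refine congrArg (v.1.1 ((I.lift L).map f)).1 (Heisenberg.ext ?_ ?_)
  · exact (add_sub_cancel _ _).symm
  · have hperp : f.toLinearEquiv (I.sec x.vec : V) ∈ J.perp := (perpEquiv f h (I.sec x.vec)).2
    have h0 := J.form_perp_eq_zero hperp hj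
    have hz : x.z = x.z + 0 + 2⁻¹ * U.form (f.toLinearEquiv (I.sec x.vec : V))
        (J.sec ((reductionIso f h).toLinearEquiv x.vec) - f.toLinearEquiv (I.sec x.vec)) := by
      rw [h0, mul_zero, add_zero, add_zero]
    exact hz

end Canonical

end OrientedIsotropic

theorem proposition5 {F : Type w} [Field F] [Fintype F] [DecidableEq F] (hF : ringChar F ≠ 2)
    (ψ : AddChar F ℂ) (hψ : ψ ≠ 1) :
    (∀ V : SympSpace.{w, u} F, ∃! S : LagSystem ψ V, IsCanonicalSystem ψ S) ∧
    ∃ α : ∀ (V : SympSpace.{w, u} F) (I : OrientedIsotropic V),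
        invariantVectors ψ I ≃ₗ[ℂ] canonicalSpace ψ I.reduction,
      (∀ (V U : SympSpace.{w, u} F) (f : SympSpace.Iso V U) (I : OrientedIsotropic V)
        (J : OrientedIsotropic U) (h : I.1.map f = J.1),
        canonicalMap ψ (OrientedIsotropic.reductionIso f h) ∘ₗ (α U J).toLinearMap =
          (α V I).toLinearMap ∘ₗ invariantMap ψ f h) ∧
      (∀ (V : SympSpace.{w, u} F) (I : OrientedIsotropic V),
        ∃ e : (invariantSubrep ψ I).toRepresentation.Equiv
            ((weilRep ψ I.reduction).comp I.stabilizerHom),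
          ∀ v : invariantVectors ψ I, e v = α V I v) := by
  refine ⟨existsUnique_isCanonicalSystem ψ hF hψ, fun V I => I.reductionEquiv ψ hF hψ,
    fun V U f I J h => OrientedIsotropic.reductionEquiv_natural ψ hF hψ f h, fun V I => ?_⟩
  refine ⟨Representation.Equiv.mk (I.reductionEquiv ψ hF hψ) fun g => ?_, fun v => rfl⟩
  -- Since `ρ(g) = H(g⁻¹)`, equivariance under `g` is naturality for the automorphism `g⁻¹` of the
  -- pair `(I°, V)`.
  have h := OrientedIsotropic.reductionEquiv_natural ψ hF hψ (g⁻¹ : I.stabilizer).1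
    (g⁻¹ : I.stabilizer).2
  exact h.symm
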